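/- Let $N\ge 2$ be an integer, let $R,A,B,p,q>0$ with $A\neq B$, and let $g\in C^\infty([0,R])$ be positive on $[0,R]$; all of these are independent of $\epsilon$. For $\epsilon>0$ let $U_\epsilon\in C^1([0,R])\cap C^\infty((0,R))$ be a solution of the radial Neumann problem (N*) $$\epsilon^2 g(r)\Big[U_\epsilon''(r)+\Big(\frac{N-1}{r}+\frac{g'(r)}{g(r)}\Big)U_\epsilon'(r)\Big]=\frac{R^N}{N}\left(\frac{Ae^{pU_\epsilon(r)}}{\int_0^R s^{N-1}e^{pU_\epsilon(s)}\,ds}-\frac{Be^{-qU_\epsilon(r)}}{\int_0^R s^{N-1}e^{-qU_\epsilon(s)}\,ds}\right),\quad r\in(0,R),$$ $$\int_0^R s^{N-1}U_\epsilon(s)\,ds=0,\qquad U_\epsilon'(0)=0,\qquad U_\epsilon'(R)=\frac{R(A-B)}{\epsilon^2Ng(R)},$$ and let $$\rho_\epsilon=-\frac{R^N}{N}\left(\frac{Ae^{pU_\epsilon}}{\int_0^R s^{N-1}e^{pU_\epsilon(s)}\,ds}-\frac{Be^{-qU_\epsilon}}{\int_0^R s^{N-1}e^{-qU_\epsilon(s)}\,ds}\right)$$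 be the net charge density. For a constant $\mathcal C\ne0$ write $f_\epsilon\rightharpoonup\mathcal C\delta_R$ if $\lim_{\epsilon\downarrow0}\int_0^R h(r)f_\epsilon(r)\,dr=\mathcal C h(R)$ for every continuous $h:[0,R]\to\mathbb R$ independent of $\epsilon$, and for $\theta>0$ write $\|f\|_{L^\theta((0,R))}=\big(\int_0^R|f|^\theta\,dr\big)^{1/\theta}$. Then, as $\epsilon\downarrow0$, $$\rho_\epsilon\rightharpoonup\frac{R(B-A)}{N}\,\delta_R,$$ and the following hold. (I) If $A<B$, then $(\epsilon U_\epsilon')^2\rightharpoonup\frac{2R(B-A)}{qNg(R)}\delta_R$ and $e^{-qU_\epsilon}-1\rightharpoonup\frac{R(B-A)}{AN}\delta_R$, while $e^{pU_\epsilon}-1\to0$ strongly in $L^\theta((0,R))$ for every $\theta>0$. (II) If $A>B$, then $(\epsilon U_\epsilon')^2\rightharpoonup\frac{2R(A-B)}{pNg(R)}\delta_R$ and $e^{pU_\epsilon}-1\rightharpoonup\frac{R(A-B)}{BN}\delta_R$, while $e^{-qU_\epsilon}-1\to0$ strongly in $L^\theta((0,R))$ for every $\theta>0$. (III) For every $\theta\in(0,2)$,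 $\epsilon U_\epsilon'\to0$ strongly in $L^\theta((0,R))$; moreover there is a constant $C_\theta>0$ independent of $\epsilon$ such that, for all sufficiently small $\epsilon>0$, $$\|\epsilon U_\epsilon'\|_{L^\theta((0,R))}\le C_\theta\,\epsilon^{\min\{1,\,2/\theta-1\}}\Big(\log\frac1\epsilon\Big)^{\chi(\theta)},$$ where $\chi(\theta)=1$ for $\theta\in(0,1]$ and $\chi(\theta)=0$ for $\theta\in(1,2)$. -/

import Mathlib

open MeasureTheory Set Filter Topology

namespace CCPB

noncomputable section

/-- The derivative of a function on the closed interval `[0, R]`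
(the usual two-sided derivative in the interior, one-sided at the endpoints). -/
def rDeriv (R : ℝ) (f : ℝ → ℝ) : ℝ → ℝ := derivWithin f (Icc 0 R)

/-- The non-local coefficient `∫₀ᴿ s^(N-1) e^(c U(s)) ds`. -/
def expMass (N : ℕ) (R c : ℝ) (U : ℝ → ℝ) : ℝ :=
  ∫ s in (0 : ℝ)..R, s ^ (N - 1) * Real.exp (c * U s)

/-- The net charge density
`-(R^N / N) (A e^{pU} / ∫₀ᴿ s^(N-1) e^{pU} ds - B e^{-qU} / ∫₀ᴿ s^(N-1) e^{-qU} ds)`. -/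
def chargeDensity (N : ℕ) (R A B p q : ℝ) (U : ℝ → ℝ) (r : ℝ) : ℝ :=
  -(R ^ N / N * (A * Real.exp (p * U r) / expMass N R p U
      - B * Real.exp (-q * U r) / expMass N R (-q) U))

/-- `U ∈ C¹([0,R]) ∩ C^∞((0,R))` is a classical solution of the radial Neumann problem
with parameter `ε`. -/
structure IsRadialNeumannSolution (N : ℕ) (R A B p q : ℝ) (g : ℝ → ℝ) (ε : ℝ)
    (U : ℝ → ℝ) : Prop where
  contDiffOn_closed : ContDiffOn ℝ 1 U (Icc 0 R)
  contDiffOn_open : ContDiffOn ℝ (⊤ : ℕ∞) U (Ioo 0 R)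
  equation : ∀ r ∈ Ioo 0 R,
    ε ^ 2 * g r * (rDeriv R (rDeriv R U) r
        + ((N - 1 : ℝ) / r + rDeriv R g r / g r) * rDeriv R U r)
      = R ^ N / N * (A * Real.exp (p * U r) / expMass N R p U
          - B * Real.exp (-q * U r) / expMass N R (-q) U)
  mean_zero : ∫ s in (0 : ℝ)..R, s ^ (N - 1) * U s = 0
  deriv_zero : rDeriv R U 0 = 0
  deriv_right : rDeriv R U R = R * (A - B) / (ε ^ 2 * N * g R)

/-- `f_ε ⇀ c δ_R` weakly in `C([0,R]; ℝ)` as `ε ↓ 0`, with a weight `c ≠ 0`: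
`∫₀ᴿ h f_ε dr → c h(R)` for every continuous `h : [0,R] → ℝ`, the integrals being genuine
(convergent) Lebesgue integrals. -/
def WeakToDelta (R : ℝ) (f : ℝ → ℝ → ℝ) (c : ℝ) : Prop :=
  c ≠ 0 ∧ ∀ h : ℝ → ℝ, ContinuousOn h (Icc 0 R) →
    (∀ᶠ ε in 𝓝[>] (0 : ℝ), IntervalIntegrable (fun r => h r * f ε r) volume 0 R) ∧
    Tendsto (fun ε => ∫ r in (0 : ℝ)..R, h r * f ε r) (𝓝[>] 0) (𝓝 (c * h R))

/-- The (quasi-)norm `(∫₀ᴿ |f|^θ dr)^(1/θ)` of `L^θ((0,R))`, `0 < θ < ∞`. -/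
def lthetaNorm (R θ : ℝ) (f : ℝ → ℝ) : ENNReal :=
  eLpNorm f (ENNReal.ofReal θ) (volume.restrict (Ioo 0 R))

/-- `f_ε → 0` strongly in `L^θ((0,R))` as `ε ↓ 0`. -/
def StrongToZero (R θ : ℝ) (f : ℝ → ℝ → ℝ) : Prop :=
  (∀ᶠ ε in 𝓝[>] (0 : ℝ), MemLp (f ε) (ENNReal.ofReal θ) (volume.restrict (Ioo 0 R))) ∧
  Tendsto (fun ε => lthetaNorm R θ (f ε)) (𝓝[>] 0) (𝓝 0)

/-- `χ(θ) = 1` for `θ ≤ 1` and `χ(θ) = 0` for `θ > 1`. -/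
def logExponent (θ : ℝ) : ℕ := if θ ≤ 1 then 1 else 0

end

end CCPB

/-! ### Divergence form of the equation, and the signs of the flux and charge when `B < A`. -/

namespace CCPB

noncomputable section

/-! The map `U ↦ -U` exchanges `(A, p)` with `(B, q)`, so it suffices to treat `B < A`. Write `a
e^{pU}` and `b e^{-qU}` for the two terms of the right-hand side, `v = a e^{pU} - b e^{-qU}`, and `W
= ε² r^(N-1) g U'`. The equation says `W' = r^(N-1) v`, with `W(0) = 0` and `W(R)` a positive number
independent of `ε`. Since `v` increases with `U`, a minimum argument gives `W ≥ 0`; hence `U` and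
`v` are nondecreasing and `v ≥ 0`. The mean-zero condition bounds the coefficients, and then `U`
from below.

The basic estimate comes from `v' ≥ p v U'`: it gives `W² ≤ K ε² v`, so near `R` the flux satisfies
the Riccati inequality `W' ≥ c W² / ε²`. Integrating back from `R` yields `W ≤ C ε² / (ε² + R - r)`
(`exists_flux_le`), hence `v ≤ C ε² / (R - r)²` (`exists_netCharge_le`) and `U' ≤ C / (ε² + R - r)`
(`exists_rDeriv_le`). The last bound gives all `L^θ` estimates by direct integration.

For the weak limits, `v` is nonnegative, monotone, of fixed weighted mass, and vanishes in the limit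
at each `r < R`, so it concentrates at `R` (`tendsto_integral_of_concentrating`). The other two
concentrating quantities equal multiples of `v` up to bounded errors that tend to zero pointwise.
For `e^{pU} - 1` this is algebra, once `U → 0` inside and `a, b → B`. For `(ε U')²` it is an
approximate conservation of energy (`exists_energy_balance`), whose error is controlled by `W`. -/

/-- The coefficient `(R^N / N) A / ∫₀ᴿ s^(N-1) e^(c U(s)) ds`. -/
def coef (N : ℕ) (R A c : ℝ) (U : ℝ → ℝ) : ℝ := R ^ N / N * A / expMass N R c U

/-- The right-hand side of the equation, i.e. minus the charge density. -/
def netCharge (N : ℕ) (R A B p q : ℝ) (U : ℝ → ℝ) (r : ℝ) : ℝ :=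
  coef N R A p U * Real.exp (p * U r) - coef N R B (-q) U * Real.exp (-q * U r)

/-- The weighted flux, `ε² r^(N-1) g` times the derivative of `U`. -/
def flux (N : ℕ) (R : ℝ) (g : ℝ → ℝ) (ε : ℝ) (U : ℝ → ℝ) (r : ℝ) : ℝ :=
  ε ^ 2 * (r ^ (N - 1) * g r * rDeriv R U r)

/-- The standing assumptions on the parameters, in the case `B < A`. -/
structure Admissible (N : ℕ) (R A B p q : ℝ) (g : ℝ → ℝ) : Prop where
  two_le : 2 ≤ N
  R_pos : 0 < R
  B_pos : 0 < B
  B_lt_A : B < A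
  p_pos : 0 < p
  q_pos : 0 < q
  smooth : ContDiffOn ℝ (⊤ : ℕ∞) g (Icc 0 R)
  g_pos : ∀ r ∈ Icc 0 R, 0 < g r

variable {N : ℕ} {R A B p q ε : ℝ} {g U : ℝ → ℝ}

lemma chargeDensity_eq_neg (r : ℝ) :
    chargeDensity N R A B p q U r = -netCharge N R A B p q U r := by
  unfold chargeDensity netCharge coef
  ring

lemma Admissible.A_pos (hP : Admissible N R A B p q g) : 0 < A := hP.B_pos.trans hP.B_lt_A

lemma Admissible.N_pos (hP : Admissible N R A B p q g) : (0 : ℝ) < N := by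
  have := hP.two_le
  exact_mod_cast (by omega : 0 < N)

lemma hasDerivAt_rDeriv {f : ℝ → ℝ} (hf : ContDiffOn ℝ 1 f (Icc 0 R)) {r : ℝ}
    (hr : r ∈ Ioo 0 R) : HasDerivAt f (rDeriv R f r) r :=
  ((hf.differentiableOn (by norm_num)) r (Ioo_subset_Icc_self hr)).hasDerivWithinAt.hasDerivAt
    (Icc_mem_nhds hr.1 hr.2)

lemma continuousOn_rDeriv (hR : 0 < R) {f : ℝ → ℝ} (hf : ContDiffOn ℝ 1 f (Icc 0 R)) :
    ContinuousOn (rDeriv R f) (Icc 0 R) :=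
  hf.continuousOn_derivWithin (uniqueDiffOn_Icc hR) le_rfl

lemma Admissible.contDiffOn_one (hP : Admissible N R A B p q g) : ContDiffOn ℝ 1 g (Icc 0 R) :=
  hP.smooth.of_le (by exact_mod_cast le_top)

namespace IsRadialNeumannSolution

lemma continuousOn (hU : IsRadialNeumannSolution N R A B p q g ε U) :
    ContinuousOn U (Icc 0 R) := hU.contDiffOn_closed.continuousOn

lemma hasDerivAt (hU : IsRadialNeumannSolution N R A B p q g ε U) {r : ℝ} (hr : r ∈ Ioo 0 R) :
    HasDerivAt U (rDeriv R U r) r := hasDerivAt_rDeriv hU.contDiffOn_closed hr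

/-- Regularity up to the boundary supplies only one derivative. The second comes from interior
smoothness, after identifying `rDeriv R U` with `deriv U` near `r`. -/
lemma hasDerivAt_two (hU : IsRadialNeumannSolution N R A B p q g ε U) {r : ℝ}
    (hr : r ∈ Ioo 0 R) : HasDerivAt (rDeriv R U) (rDeriv R (rDeriv R U) r) r := by
  have h1 : ContDiffOn ℝ 1 (deriv U) (Ioo 0 R) :=
    hU.contDiffOn_open.deriv_of_isOpen isOpen_Ioo (by norm_num; exact WithTop.coe_le_coe.2 (le_top : (2 : ℕ∞) ≤ ⊤))
  have h2 : DifferentiableAt ℝ (deriv U) r :=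
    (h1.differentiableOn (by norm_num)).differentiableAt (Ioo_mem_nhds hr.1 hr.2)
  have he : rDeriv R U =ᶠ[𝓝 r] deriv U := by
    filter_upwards [Ioo_mem_nhds hr.1 hr.2] with s hs
    exact (hU.hasDerivAt hs).deriv.symm
  have h3 : DifferentiableAt ℝ (rDeriv R U) r := h2.congr_of_eventuallyEq he
  have h4 : rDeriv R (rDeriv R U) r = deriv (rDeriv R U) r :=
    derivWithin_of_mem_nhds (Icc_mem_nhds hr.1 hr.2)
  rw [h4]
  exact h3.hasDerivAt

lemma hasDerivAt_exp (hU : IsRadialNeumannSolution N R A B p q g ε U) (c : ℝ) {r : ℝ}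
    (hr : r ∈ Ioo 0 R) :
    HasDerivAt (fun s => Real.exp (c * U s)) (c * Real.exp (c * U r) * rDeriv R U r) r := by
  have := ((hU.hasDerivAt hr).const_mul c).exp
  convert this using 1
  ring

lemma continuousOn_exp (hU : IsRadialNeumannSolution N R A B p q g ε U) (c : ℝ) :
    ContinuousOn (fun s => Real.exp (c * U s)) (Icc 0 R) :=
  (hU.continuousOn.const_mul c).rexp

lemma continuousOn_netCharge (hU : IsRadialNeumannSolution N R A B p q g ε U) :
    ContinuousOn (netCharge N R A B p q U) (Icc 0 R) :=
  ((hU.continuousOn_exp p).const_mul _).sub ((hU.continuousOn_exp (-q)).const_mul _)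

lemma hasDerivAt_netCharge (hU : IsRadialNeumannSolution N R A B p q g ε U) {r : ℝ}
    (hr : r ∈ Ioo 0 R) :
    HasDerivAt (netCharge N R A B p q U)
      ((p * (coef N R A p U * Real.exp (p * U r))
        + q * (coef N R B (-q) U * Real.exp (-q * U r))) * rDeriv R U r) r := by
  have := ((hU.hasDerivAt_exp p hr).const_mul (coef N R A p U)).sub
    ((hU.hasDerivAt_exp (-q) hr).const_mul (coef N R B (-q) U))
  exact this.congr_deriv (by ring)

lemma continuousOn_flux (hU : IsRadialNeumannSolution N R A B p q g ε U)
    (hP : Admissible N R A B p q g) : ContinuousOn (flux N R g ε U) (Icc 0 R) :=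
  (((continuous_pow _).continuousOn.mul hP.smooth.continuousOn).mul
    (continuousOn_rDeriv hP.R_pos hU.contDiffOn_closed)).const_mul _

lemma hasDerivAt_flux (hU : IsRadialNeumannSolution N R A B p q g ε U)
    (hP : Admissible N R A B p q g) {r : ℝ} (hr : r ∈ Ioo 0 R) :
    HasDerivAt (flux N R g ε U) (r ^ (N - 1) * netCharge N R A B p q U r) r := by
  have h1 := (((hasDerivAt_pow (N - 1) r).mul (hasDerivAt_rDeriv hP.contDiffOn_one hr)).mul
    (hU.hasDerivAt_two hr)).const_mul (ε ^ 2)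
  have heq := hU.equation r hr
  have hg : g r ≠ 0 := (hP.g_pos r (Ioo_subset_Icc_self hr)).ne'
  have hr0 : r ≠ 0 := hr.1.ne'
  have hv : netCharge N R A B p q U r = ε ^ 2 * g r * (rDeriv R (rDeriv R U) r
        + ((N - 1 : ℝ) / r + rDeriv R g r / g r) * rDeriv R U r) := by
    rw [heq]; unfold netCharge coef; ring
  rw [hv]
  -- This substitution removes the truncated subtractions in the exponents `N - 1` and `N - 1 - 1`.
  obtain ⟨n, rfl⟩ : ∃ n, N = n + 2 := ⟨N - 2, by have := hP.two_le; omega⟩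
  refine h1.congr_deriv ?_
  simp only [show n + 2 - 1 = n + 1 by omega, show n + 1 - 1 = n by omega, Pi.mul_apply]
  push_cast
  field_simp
  ring

lemma flux_zero (hU : IsRadialNeumannSolution N R A B p q g ε U) : flux N R g ε U 0 = 0 := by
  simp [flux, hU.deriv_zero]

lemma flux_right (hU : IsRadialNeumannSolution N R A B p q g ε U)
    (hP : Admissible N R A B p q g) (hε : 0 < ε) :
    flux N R g ε U R = R ^ N * (A - B) / N := by
  have hg : g R ≠ 0 := (hP.g_pos R ⟨hP.R_pos.le, le_rfl⟩).ne'
  have hN := hP.N_pos.ne'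
  rw [flux, hU.deriv_right]
  obtain ⟨n, rfl⟩ : ∃ n, N = n + 2 := ⟨N - 2, by have := hP.two_le; omega⟩
  simp only [show n + 2 - 1 = n + 1 by omega]
  field_simp
  ring

lemma intervalIntegrable_weight (hU : IsRadialNeumannSolution N R A B p q g ε U) (hR : 0 < R)
    (c : ℝ) : IntervalIntegrable (fun s => s ^ (N - 1) * Real.exp (c * U s)) volume 0 R := by
  apply ContinuousOn.intervalIntegrable
  rw [uIcc_of_le hR.le]
  exact (continuous_pow _).continuousOn.mul (hU.continuousOn_exp c)

lemma integral_weight (hP : Admissible N R A B p q g) :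
    ∫ s in (0 : ℝ)..R, s ^ (N - 1) = R ^ N / N := by
  obtain ⟨n, rfl⟩ : ∃ n, N = n + 2 := ⟨N - 2, by have := hP.two_le; omega⟩
  rw [integral_pow]
  push_cast
  norm_num
  ring_nf

/-- Integrate `e^x ≥ 1 + x` at `x = c U` against the weight; the linear term vanishes by the
mean-zero condition. -/
lemma expMass_ge (hU : IsRadialNeumannSolution N R A B p q g ε U)
    (hP : Admissible N R A B p q g) (c : ℝ) : R ^ N / N ≤ expMass N R c U := by
  have hR := hP.R_pos
  have i1 : IntervalIntegrable (fun s : ℝ => s ^ (N - 1)) volume 0 R :=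
    (continuous_pow _).intervalIntegrable _ _
  have i2 : IntervalIntegrable (fun s : ℝ => c * (s ^ (N - 1) * U s)) volume 0 R := by
    apply ContinuousOn.intervalIntegrable
    rw [uIcc_of_le hR.le]
    exact ((continuous_pow _).continuousOn.mul hU.continuousOn).const_mul c
  have : ∫ s in (0 : ℝ)..R, (s ^ (N - 1) + c * (s ^ (N - 1) * U s)) = R ^ N / N := by
    rw [intervalIntegral.integral_add i1 i2, intervalIntegral.integral_const_mul, hU.mean_zero,
      integral_weight hP]
    ring
  rw [← this]
  refine intervalIntegral.integral_mono_on hR.le (i1.add i2)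
    (hU.intervalIntegrable_weight hR c) fun s hs => ?_
  have h1 := mul_le_mul_of_nonneg_left (Real.add_one_le_exp (c * U s)) (pow_nonneg hs.1 (N - 1))
  nlinarith

lemma mass_pos (hP : Admissible N R A B p q g) : 0 < R ^ N / (N : ℝ) :=
  div_pos (pow_pos hP.R_pos _) hP.N_pos

lemma expMass_pos (hU : IsRadialNeumannSolution N R A B p q g ε U)
    (hP : Admissible N R A B p q g) (c : ℝ) : 0 < expMass N R c U :=
  (mass_pos hP).trans_le (hU.expMass_ge hP c)

lemma coef_pos (hU : IsRadialNeumannSolution N R A B p q g ε U)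
    (hP : Admissible N R A B p q g) {D : ℝ} (hD : 0 < D) (c : ℝ) : 0 < coef N R D c U :=
  div_pos (mul_pos (mass_pos hP) hD) (hU.expMass_pos hP c)

lemma coef_le (hU : IsRadialNeumannSolution N R A B p q g ε U)
    (hP : Admissible N R A B p q g) {D : ℝ} (hD : 0 < D) (c : ℝ) : coef N R D c U ≤ D := by
  rw [coef, div_le_iff₀ (hU.expMass_pos hP c), mul_comm]
  exact mul_le_mul_of_nonneg_left (hU.expMass_ge hP c) hD.le

lemma netCharge_le_of_le (hU : IsRadialNeumannSolution N R A B p q g ε U)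
    (hP : Admissible N R A B p q g) {r s : ℝ} (h : U r ≤ U s) :
    netCharge N R A B p q U r ≤ netCharge N R A B p q U s := by
  have ha := hU.coef_pos hP hP.A_pos p
  have hb := hU.coef_pos hP hP.B_pos (-q)
  have h1 : Real.exp (p * U r) ≤ Real.exp (p * U s) :=
    Real.exp_le_exp.2 (mul_le_mul_of_nonneg_left h hP.p_pos.le)
  have h2 : Real.exp (-q * U s) ≤ Real.exp (-q * U r) :=
    Real.exp_le_exp.2 (by nlinarith [hP.q_pos])
  unfold netCharge
  exact sub_le_sub (mul_le_mul_of_nonneg_left h1 ha.le) (mul_le_mul_of_nonneg_left h2 hb.le)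

lemma rDeriv_nonneg_iff_flux (hP : Admissible N R A B p q g) (hε : 0 < ε) {r : ℝ}
    (hr : r ∈ Ioc 0 R) : 0 ≤ flux N R g ε U r ↔ 0 ≤ rDeriv R U r := by
  have h : 0 < ε ^ 2 * (r ^ (N - 1) * g r) :=
    mul_pos (pow_pos hε 2) (mul_pos (pow_pos hr.1 _) (hP.g_pos r ⟨hr.1.le, hr.2⟩))
  have : flux N R g ε U r = ε ^ 2 * (r ^ (N - 1) * g r) * rDeriv R U r := by
    unfold flux; ring
  rw [this, mul_nonneg_iff_of_pos_left h]

/-- The boundary values force a negative minimum `t` to be interior, so `v(t) = 0` while `U'(t) <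
0`. Then `v` becomes negative just after `t`, and the flux would decrease below its minimum. -/
lemma flux_nonneg (hU : IsRadialNeumannSolution N R A B p q g ε U)
    (hP : Admissible N R A B p q g) (hε : 0 < ε) {r : ℝ} (hr : r ∈ Icc 0 R) :
    0 ≤ flux N R g ε U r := by
  by_contra! hneg
  have hR := hP.R_pos
  obtain ⟨t, ht, hmin⟩ := isCompact_Icc.exists_isMinOn (nonempty_Icc.2 hR.le)
    (hU.continuousOn_flux hP)
  have htneg : flux N R g ε U t < 0 := lt_of_le_of_lt (hmin hr) hneg
  have ht0 : t ≠ 0 := by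
    rintro rfl; rw [hU.flux_zero] at htneg; exact lt_irrefl _ htneg
  have htR : t ≠ R := by
    rintro rfl
    rw [hU.flux_right hP hε] at htneg
    have : 0 < t ^ N * (A - B) / N :=
      div_pos (mul_pos (pow_pos hR _) (sub_pos.2 hP.B_lt_A)) hP.N_pos
    linarith
  have htI : t ∈ Ioo 0 R := ⟨lt_of_le_of_ne ht.1 ht0.symm, lt_of_le_of_ne ht.2 htR⟩
  have hloc : IsLocalMin (flux N R g ε U) t :=
    hmin.isLocalMin (Icc_mem_nhds htI.1 htI.2)
  have hv0 : netCharge N R A B p q U t = 0 := by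
    have := hloc.hasDerivAt_eq_zero (hU.hasDerivAt_flux hP htI)
    exact (mul_eq_zero.1 this).resolve_left (pow_pos htI.1 _).ne'
  have hdU : rDeriv R U t < 0 := by
    by_contra! h
    have := (rDeriv_nonneg_iff_flux (U := U) hP hε ⟨htI.1, ht.2⟩).2 h
    linarith
  have hdv : (p * (coef N R A p U * Real.exp (p * U t))
        + q * (coef N R B (-q) U * Real.exp (-q * U t))) * rDeriv R U t < 0 := by
    have ha := hU.coef_pos hP hP.A_pos p
    have hb := hU.coef_pos hP hP.B_pos (-q)
    have := hP.p_pos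
    have := hP.q_pos
    exact mul_neg_of_pos_of_neg (by positivity) hdU
  -- `v` vanishes at `t` and has negative derivative there, so it is negative immediately to the
  -- right.
  have hev : ∀ᶠ s in 𝓝[>] t, netCharge N R A B p q U s < 0 := by
    have h1 := (hasDerivAt_iff_tendsto_slope.1 (hU.hasDerivAt_netCharge htI)).eventually
      (gt_mem_nhds hdv)
    have h2 : 𝓝[>] t ≤ 𝓝[≠] t := nhdsWithin_mono _ fun x hx => ne_of_gt hx
    filter_upwards [h2 h1, self_mem_nhdsWithin] with s hs hst
    have hst' : 0 < s - t := sub_pos.2 hst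
    rw [slope_def_field, hv0, sub_zero, div_lt_iff₀ hst', zero_mul] at hs
    exact hs
  obtain ⟨u, hu, hsub⟩ := (mem_nhdsGT_iff_exists_Ioo_subset' htI.2).1
    (inter_mem hev (Ioo_mem_nhdsGT htI.2))
  have hu' : t < u := hu
  set m := (t + u) / 2
  have hm : m ∈ Ioo t u := ⟨by simp only [m]; linarith, by simp only [m]; linarith⟩
  have hmR : m < R := (hsub hm).2.2
  have hanti : StrictAntiOn (flux N R g ε U) (Icc t m) := by
    refine strictAntiOn_of_deriv_neg (convex_Icc _ _)
      ((hU.continuousOn_flux hP).mono (Icc_subset_Icc ht.1 hmR.le)) fun x hx => ?_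
    rw [interior_Icc] at hx
    have hxR : x ∈ Ioo 0 R := ⟨htI.1.trans hx.1, hx.2.trans hmR⟩
    rw [(hU.hasDerivAt_flux hP hxR).deriv]
    exact mul_neg_of_pos_of_neg (pow_pos hxR.1 _) (hsub ⟨hx.1, hx.2.trans hm.2⟩).1
  have h1 := hanti (left_mem_Icc.2 hm.1.le) (right_mem_Icc.2 hm.1.le) hm.1
  have h2 : flux N R g ε U t ≤ flux N R g ε U m := hmin ⟨ht.1.trans hm.1.le, hmR.le⟩
  linarith

lemma rDeriv_nonneg (hU : IsRadialNeumannSolution N R A B p q g ε U)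
    (hP : Admissible N R A B p q g) (hε : 0 < ε) {r : ℝ} (hr : r ∈ Icc 0 R) :
    0 ≤ rDeriv R U r := by
  rcases eq_or_lt_of_le hr.1 with h | h
  · rw [← h, hU.deriv_zero]
  · exact (rDeriv_nonneg_iff_flux hP hε ⟨h, hr.2⟩).1 (hU.flux_nonneg hP hε hr)

lemma monotoneOn (hU : IsRadialNeumannSolution N R A B p q g ε U)
    (hP : Admissible N R A B p q g) (hε : 0 < ε) : MonotoneOn U (Icc 0 R) := by
  refine monotoneOn_of_hasDerivWithinAt_nonneg (f' := rDeriv R U) (convex_Icc _ _)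
    hU.continuousOn (fun x hx => ?_) fun x hx => ?_
  · rw [interior_Icc] at hx ⊢
    exact (hU.hasDerivAt hx).hasDerivWithinAt
  · rw [interior_Icc] at hx
    exact hU.rDeriv_nonneg hP hε (Ioo_subset_Icc_self hx)

lemma monotoneOn_netCharge (hU : IsRadialNeumannSolution N R A B p q g ε U)
    (hP : Admissible N R A B p q g) (hε : 0 < ε) :
    MonotoneOn (netCharge N R A B p q U) (Icc 0 R) :=
  fun _ hx _ hy hxy => hU.netCharge_le_of_le hP (hU.monotoneOn hP hε hx hy hxy)

/-- By monotonicity, a negative value of `v` persists down to the origin, where it would push the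
flux below its initial value zero. -/
lemma netCharge_nonneg (hU : IsRadialNeumannSolution N R A B p q g ε U)
    (hP : Admissible N R A B p q g) (hε : 0 < ε) {r : ℝ} (hr : r ∈ Icc 0 R) :
    0 ≤ netCharge N R A B p q U r := by
  have hR := hP.R_pos
  by_contra! hneg
  have hrpos : 0 ≤ r := hr.1
  have hlt : ∀ x ∈ Icc 0 r, netCharge N R A B p q U x < 0 := fun x hx =>
    (hU.monotoneOn_netCharge hP hε ⟨hx.1, hx.2.trans hr.2⟩ hr hx.2).trans_lt hneg
  -- If `r = 0`, monotonicity gives no interval; continuity at the origin supplies one.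
  have h0 : ∃ m, 0 < m ∧ m ≤ R ∧ ∀ x ∈ Ioo 0 m, netCharge N R A B p q U x < 0 := by
    rcases eq_or_lt_of_le hrpos with h | h
    · have hc : ContinuousWithinAt (netCharge N R A B p q U) (Icc 0 R) 0 :=
        hU.continuousOn_netCharge 0 ⟨le_rfl, hR.le⟩
      rw [← h] at hneg
      have := hc.eventually (gt_mem_nhds hneg)
      have h2 : ∀ᶠ x in 𝓝[>] (0 : ℝ), netCharge N R A B p q U x < 0 := by
        refine Filter.Eventually.filter_mono ?_ this
        rw [← nhdsWithin_Ioo_eq_nhdsGT hR]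
        exact nhdsWithin_mono _ Ioo_subset_Icc_self
      obtain ⟨u, hu, hsub⟩ := (mem_nhdsGT_iff_exists_Ioo_subset' hR).1 h2
      exact ⟨min u R, lt_min hu hR, min_le_right _ _, fun x hx =>
        hsub ⟨hx.1, hx.2.trans_le (min_le_left _ _)⟩⟩
    · exact ⟨r, h, hr.2, fun x hx => hlt x (Ioo_subset_Icc_self hx)⟩
  obtain ⟨m, hm, hmR, hmneg⟩ := h0
  have hanti : StrictAntiOn (flux N R g ε U) (Icc 0 m) := by
    refine strictAntiOn_of_deriv_neg (convex_Icc _ _)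
      ((hU.continuousOn_flux hP).mono (Icc_subset_Icc le_rfl hmR)) fun x hx => ?_
    rw [interior_Icc] at hx
    have hxR : x ∈ Ioo 0 R := ⟨hx.1, hx.2.trans_le hmR⟩
    rw [(hU.hasDerivAt_flux hP hxR).deriv]
    exact mul_neg_of_pos_of_neg (pow_pos hxR.1 _) (hmneg x hx)
  have h1 := hanti (left_mem_Icc.2 hm.le) (right_mem_Icc.2 hm.le) hm
  rw [hU.flux_zero] at h1
  have := hU.flux_nonneg hP hε ⟨hm.le, hmR⟩
  linarith

end IsRadialNeumannSolution

end

end CCPB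

/-! ### Uniform bounds on the coefficients, and boundary-layer estimates. -/

namespace CCPB

noncomputable section

variable {N : ℕ} {R A B p q ε : ℝ} {g U : ℝ → ℝ}

lemma le_of_hasDerivAt_nonneg {f f' : ℝ → ℝ} {a b : ℝ} (hab : a ≤ b)
    (hc : ContinuousOn f (Icc a b)) (hd : ∀ x ∈ Ioo a b, HasDerivAt f (f' x) x)
    (h0 : ∀ x ∈ Ioo a b, 0 ≤ f' x) : f a ≤ f b := by
  refine monotoneOn_of_hasDerivWithinAt_nonneg (f' := f') (convex_Icc a b) hc
    (fun x hx => ?_) (fun x hx => ?_) (left_mem_Icc.2 hab) (right_mem_Icc.2 hab) hab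
  · rw [interior_Icc] at hx ⊢
    exact (hd x hx).hasDerivWithinAt
  · rw [interior_Icc] at hx
    exact h0 x hx

lemma Admissible.exists_bounds (hP : Admissible N R A B p q g) :
    ∃ g₀ g₁ : ℝ, 0 < g₀ ∧ 0 < g₁ ∧ ∀ r ∈ Icc 0 R, g₀ ≤ g r ∧ g r ≤ g₁ ∧ |rDeriv R g r| ≤ g₁ := by
  have hne : (Icc 0 R).Nonempty := nonempty_Icc.2 hP.R_pos.le
  obtain ⟨x, hx, hmin⟩ := isCompact_Icc.exists_isMinOn hne hP.smooth.continuousOn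
  obtain ⟨y, hy, hmax⟩ := isCompact_Icc.exists_isMaxOn hne hP.smooth.continuousOn
  obtain ⟨z, hz, hmaxd⟩ := isCompact_Icc.exists_isMaxOn hne
    (continuousOn_rDeriv hP.R_pos hP.contDiffOn_one).abs
  refine ⟨g x, max (g y) |rDeriv R g z|, hP.g_pos x hx,
    lt_max_of_lt_left (hP.g_pos y hy), fun r hr => ⟨hmin hr, ?_, ?_⟩⟩
  · exact le_max_of_le_left (hmax hr)
  · exact le_max_of_le_right (hmaxd hr)

namespace IsRadialNeumannSolution

lemma monotoneOn_flux (hU : IsRadialNeumannSolution N R A B p q g ε U)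
    (hP : Admissible N R A B p q g) (hε : 0 < ε) : MonotoneOn (flux N R g ε U) (Icc 0 R) := by
  intro x hx y hy hxy
  refine le_of_hasDerivAt_nonneg hxy
    ((hU.continuousOn_flux hP).mono (Icc_subset_Icc hx.1 hy.2))
    (fun s hs => hU.hasDerivAt_flux hP ⟨hx.1.trans_lt hs.1, hs.2.trans_le hy.2⟩) fun s hs => ?_
  have hs0 : 0 < s := hx.1.trans_lt hs.1
  exact mul_nonneg (pow_nonneg hs0.le _)
    (hU.netCharge_nonneg hP hε ⟨hs0.le, hs.2.le.trans hy.2⟩)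

lemma integral_coef (hU : IsRadialNeumannSolution N R A B p q g ε U)
    (hP : Admissible N R A B p q g) (D c : ℝ) :
    ∫ s in (0 : ℝ)..R, s ^ (N - 1) * (coef N R D c U * Real.exp (c * U s)) = R ^ N / N * D := by
  have h : ∀ s : ℝ, s ^ (N - 1) * (coef N R D c U * Real.exp (c * U s))
      = coef N R D c U * (s ^ (N - 1) * Real.exp (c * U s)) := fun s => by ring
  simp only [h, intervalIntegral.integral_const_mul]
  exact div_mul_cancel₀ _ (hU.expMass_pos hP c).ne'

lemma integral_weight_netCharge (hU : IsRadialNeumannSolution N R A B p q g ε U)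
    (hP : Admissible N R A B p q g) :
    ∫ s in (0 : ℝ)..R, s ^ (N - 1) * netCharge N R A B p q U s = R ^ N / N * (A - B) := by
  have hi : ∀ D c : ℝ, IntervalIntegrable
      (fun s => s ^ (N - 1) * (coef N R D c U * Real.exp (c * U s))) volume 0 R := by
    intro D c
    apply ContinuousOn.intervalIntegrable
    rw [uIcc_of_le hP.R_pos.le]
    exact (continuous_pow _).continuousOn.mul ((hU.continuousOn_exp c).const_mul _)
  simp only [netCharge, mul_sub]
  rw [intervalIntegral.integral_sub (hi _ _) (hi _ _), hU.integral_coef hP, hU.integral_coef hP]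

lemma value_zero_nonpos (hU : IsRadialNeumannSolution N R A B p q g ε U)
    (hP : Admissible N R A B p q g) (hε : 0 < ε) : U 0 ≤ 0 := by
  have hR := hP.R_pos
  have h : ∫ s in (0 : ℝ)..R, s ^ (N - 1) * U 0 ≤ ∫ s in (0 : ℝ)..R, s ^ (N - 1) * U s := by
    refine intervalIntegral.integral_mono_on hR.le
      (((continuous_pow _).mul continuous_const).intervalIntegrable _ _) ?_ fun s hs => ?_
    · apply ContinuousOn.intervalIntegrable
      rw [uIcc_of_le hR.le]
      exact (continuous_pow _).continuousOn.mul hU.continuousOn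
    · exact mul_le_mul_of_nonneg_left
        (hU.monotoneOn hP hε ⟨le_rfl, hR.le⟩ hs hs.1) (pow_nonneg hs.1 _)
  rw [hU.mean_zero, intervalIntegral.integral_mul_const, integral_weight hP] at h
  exact nonpos_of_mul_nonpos_right h (mass_pos hP)

/-- The weighted average of `b e^{-qU}` is `B`, and this function is largest at the origin because
`U` is nondecreasing. -/
lemma le_coef_mul_exp_neg (hU : IsRadialNeumannSolution N R A B p q g ε U)
    (hP : Admissible N R A B p q g) (hε : 0 < ε) :
    B ≤ coef N R B (-q) U * Real.exp (-q * U 0) := by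
  have hR := hP.R_pos
  have h : ∫ s in (0 : ℝ)..R, s ^ (N - 1) * (coef N R B (-q) U * Real.exp (-q * U s))
      ≤ ∫ s in (0 : ℝ)..R, s ^ (N - 1) * (coef N R B (-q) U * Real.exp (-q * U 0)) := by
    refine intervalIntegral.integral_mono_on hR.le ?_
      (((continuous_pow _).mul continuous_const).intervalIntegrable _ _) fun s hs => ?_
    · apply ContinuousOn.intervalIntegrable
      rw [uIcc_of_le hR.le]
      exact (continuous_pow _).continuousOn.mul ((hU.continuousOn_exp (-q)).const_mul _)
    · have h1 := hU.monotoneOn hP hε ⟨le_rfl, hR.le⟩ hs hs.1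
      have h2 : Real.exp (-q * U s) ≤ Real.exp (-q * U 0) :=
        Real.exp_le_exp.2 (by nlinarith [hP.q_pos])
      exact mul_le_mul_of_nonneg_left
        (mul_le_mul_of_nonneg_left h2 (hU.coef_pos hP hP.B_pos _).le) (pow_nonneg hs.1 _)
  rw [hU.integral_coef hP, intervalIntegral.integral_mul_const, integral_weight hP] at h
  exact le_of_mul_le_mul_left h (mass_pos hP)

/-- At the origin, `v(0) ≥ 0` transfers the lower bound `B` from `b e^{-qU}` to `a e^{pU}`;
monotonicity of `U` carries it to `r`. -/
lemma le_coef_mul_exp (hU : IsRadialNeumannSolution N R A B p q g ε U)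
    (hP : Admissible N R A B p q g) (hε : 0 < ε) {r : ℝ} (hr : r ∈ Icc 0 R) :
    B ≤ coef N R A p U * Real.exp (p * U r) := by
  have hR := hP.R_pos
  have h1 := hU.netCharge_nonneg hP hε (r := 0) ⟨le_rfl, hR.le⟩
  have h2 := hU.le_coef_mul_exp_neg hP hε
  have h3 : Real.exp (p * U 0) ≤ Real.exp (p * U r) := Real.exp_le_exp.2
    (mul_le_mul_of_nonneg_left (hU.monotoneOn hP hε ⟨le_rfl, hR.le⟩ hr hr.1) hP.p_pos.le)
  have h4 := mul_le_mul_of_nonneg_left h3 (hU.coef_pos hP hP.A_pos p).le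
  unfold netCharge at h1
  linarith

lemma le_coef (hU : IsRadialNeumannSolution N R A B p q g ε U)
    (hP : Admissible N R A B p q g) (hε : 0 < ε) : B ≤ coef N R A p U := by
  have h1 := hU.le_coef_mul_exp hP hε (r := 0) ⟨le_rfl, hP.R_pos.le⟩
  have h2 : Real.exp (p * U 0) ≤ 1 := Real.exp_le_one_iff.2
    (mul_nonpos_of_nonneg_of_nonpos hP.p_pos.le (hU.value_zero_nonpos hP hε))
  nlinarith [hU.coef_pos hP hP.A_pos p]

/-- Combine `a e^{pU(0)} ≥ B` with `a ≤ A`. This makes `e^{-qU}` bounded uniformly in `ε`. -/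
lemma value_ge (hU : IsRadialNeumannSolution N R A B p q g ε U)
    (hP : Admissible N R A B p q g) (hε : 0 < ε) {r : ℝ} (hr : r ∈ Icc 0 R) :
    Real.log (B / A) / p ≤ U r := by
  have hA := hP.A_pos
  have h0 : (0 : ℝ) ∈ Icc 0 R := ⟨le_rfl, hP.R_pos.le⟩
  refine le_trans ?_ (hU.monotoneOn hP hε h0 hr hr.1)
  rw [div_le_iff₀ hP.p_pos, Real.log_le_iff_le_exp (div_pos hP.B_pos hA), div_le_iff₀ hA,
    mul_comm (U 0) p]
  have h1 := hU.le_coef_mul_exp hP hε h0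
  have h2 := mul_le_mul_of_nonneg_right (hU.coef_le hP hA p) (Real.exp_pos (p * U 0)).le
  linarith

lemma exp_neg_le (hU : IsRadialNeumannSolution N R A B p q g ε U)
    (hP : Admissible N R A B p q g) (hε : 0 < ε) {r : ℝ} (hr : r ∈ Icc 0 R) :
    Real.exp (-q * U r) ≤ Real.exp (-q * (Real.log (B / A) / p)) :=
  Real.exp_le_exp.2 (by nlinarith [hU.value_ge hP hε hr, hP.q_pos])

/-- `v' ≥ p a e^{pU} U' ≥ p B U'`, so smallness of `v` controls the oscillation of `U`. -/
lemma value_sub_le (hU : IsRadialNeumannSolution N R A B p q g ε U)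
    (hP : Admissible N R A B p q g) (hε : 0 < ε) {r : ℝ} (hr : r ∈ Icc 0 R) :
    p * B * (U r - U 0) ≤ netCharge N R A B p q U r := by
  have hsub : Icc 0 r ⊆ Icc 0 R := Icc_subset_Icc le_rfl hr.2
  have h := le_of_hasDerivAt_nonneg (f := fun s => netCharge N R A B p q U s - p * B * U s)
    hr.1 ((hU.continuousOn_netCharge.sub (hU.continuousOn.const_mul _)).mono hsub)
    (fun s hs => (hU.hasDerivAt_netCharge ⟨hs.1, hs.2.trans_le hr.2⟩).sub
      ((hU.hasDerivAt ⟨hs.1, hs.2.trans_le hr.2⟩).const_mul (p * B))) fun s hs => by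
      have hs' : s ∈ Icc 0 R := hsub (Ioo_subset_Icc_self hs)
      have h1 := mul_le_mul_of_nonneg_left (hU.le_coef_mul_exp hP hε hs') hP.p_pos.le
      have h2 : 0 ≤ q * (coef N R B (-q) U * Real.exp (-q * U s)) :=
        mul_nonneg hP.q_pos.le (mul_nonneg (hU.coef_pos hP hP.B_pos _).le (Real.exp_pos _).le)
      have h3 := hU.rDeriv_nonneg hP hε hs'
      rw [← sub_mul]
      exact mul_nonneg (by linarith) h3
  have h0 := hU.netCharge_nonneg hP hε (r := 0) ⟨le_rfl, hP.R_pos.le⟩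
  linarith

lemma mul_netCharge_le_deriv (hU : IsRadialNeumannSolution N R A B p q g ε U)
    (hP : Admissible N R A B p q g) (hε : 0 < ε) {r : ℝ} (hr : r ∈ Icc 0 R) :
    p * netCharge N R A B p q U r * rDeriv R U r
      ≤ (p * (coef N R A p U * Real.exp (p * U r))
        + q * (coef N R B (-q) U * Real.exp (-q * U r))) * rDeriv R U r := by
  refine mul_le_mul_of_nonneg_right ?_ (hU.rDeriv_nonneg hP hε hr)
  have h : 0 ≤ coef N R B (-q) U * Real.exp (-q * U r) :=
    mul_nonneg (hU.coef_pos hP hP.B_pos _).le (Real.exp_pos _).le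
  unfold netCharge
  nlinarith [mul_nonneg hP.q_pos.le h, mul_nonneg hP.p_pos.le h]

/-- Compare derivatives: `(W²)' = 2 ε² s^(2(N-1)) g U' v`, while `v' ≥ p v U'`. At the origin `W`
vanishes and `v ≥ 0`. -/
lemma exists_flux_sq_le (hP : Admissible N R A B p q g) :
    ∃ K : ℝ, 0 < K ∧ ∀ (ε : ℝ) (U : ℝ → ℝ), 0 < ε →
      IsRadialNeumannSolution N R A B p q g ε U → ∀ r ∈ Icc 0 R,
        flux N R g ε U r ^ 2 ≤ K * ε ^ 2 * netCharge N R A B p q U r := by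
  obtain ⟨g₀, g₁, hg₀, hg₁, hg⟩ := hP.exists_bounds
  have hR := hP.R_pos
  have hp := hP.p_pos
  refine ⟨2 * ((R ^ (N - 1)) ^ 2 * g₁) / p, by positivity, fun ε U hε hU r hr => ?_⟩
  set K := 2 * ((R ^ (N - 1)) ^ 2 * g₁) / p with hK
  have hKp : K * p = 2 * ((R ^ (N - 1)) ^ 2 * g₁) := by rw [hK]; field_simp
  have hsub : Icc 0 r ⊆ Icc 0 R := Icc_subset_Icc le_rfl hr.2
  have h := le_of_hasDerivAt_nonneg
    (f := fun s => K * ε ^ 2 * netCharge N R A B p q U s - flux N R g ε U s ^ 2)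
    hr.1 (((hU.continuousOn_netCharge.const_mul _).sub ((hU.continuousOn_flux hP).pow 2)).mono
      hsub)
    (fun s hs => ((hU.hasDerivAt_netCharge ⟨hs.1, hs.2.trans_le hr.2⟩).const_mul
      (K * ε ^ 2)).sub ((hU.hasDerivAt_flux hP ⟨hs.1, hs.2.trans_le hr.2⟩).pow 2)) fun s hs => by
      have hs' : s ∈ Icc 0 R := hsub (Ioo_subset_Icc_self hs)
      have h1 := hU.mul_netCharge_le_deriv hP hε hs'
      have h2 := hU.rDeriv_nonneg hP hε hs'
      have h3 := hU.netCharge_nonneg hP hε hs'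
      have h4 : (s ^ (N - 1)) ^ 2 * g s ≤ (R ^ (N - 1)) ^ 2 * g₁ :=
        mul_le_mul (pow_le_pow_left₀ (pow_nonneg hs'.1 _)
          (pow_le_pow_left₀ hs'.1 hs'.2 _) 2) (hg s hs').2.1
          (hP.g_pos s hs').le (by positivity)
      have h5 := mul_le_mul_of_nonneg_left h4
        (mul_nonneg (mul_nonneg (sq_nonneg ε) h2) h3)
      have h6 := mul_le_mul_of_nonneg_left h1 (show 0 ≤ K * ε ^ 2 by positivity)
      have h7 : K * ε ^ 2 * (p * netCharge N R A B p q U s * rDeriv R U s)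
        = 2 * (ε ^ 2 * rDeriv R U s * netCharge N R A B p q U s
            * ((R ^ (N - 1)) ^ 2 * g₁)) := by
        linear_combination (ε ^ 2 * rDeriv R U s * netCharge N R A B p q U s) * hKp
      have h8 : (2 : ℕ) * flux N R g ε U s ^ (2 - 1) * (s ^ (N - 1) * netCharge N R A B p q U s)
        = 2 * (ε ^ 2 * rDeriv R U s * netCharge N R A B p q U s
            * ((s ^ (N - 1)) ^ 2 * g s)) := by
        unfold flux; norm_num; ring
      rw [h8]
      linarith
  have h0 := hU.netCharge_nonneg hP hε (r := 0) ⟨le_rfl, hR.le⟩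
  simp only [hU.flux_zero] at h
  have : 0 ≤ K * ε ^ 2 * netCharge N R A B p q U 0 := mul_nonneg (by positivity) h0
  linarith

/-- On `[R/2, R]` the weight is bounded below, so `exists_flux_sq_le` becomes `W' ≥ c W² / ε²`, that
is `(-1/W)' ≥ c / ε²`. Integrating from `r` to `R` uses the known value of `W(R)`. -/
lemma exists_flux_le (hP : Admissible N R A B p q g) :
    ∃ C : ℝ, 0 < C ∧ ∀ (ε : ℝ) (U : ℝ → ℝ), 0 < ε →
      IsRadialNeumannSolution N R A B p q g ε U → ∀ r ∈ Icc (R / 2) R,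
        flux N R g ε U r * (ε ^ 2 + (R - r)) ≤ C * ε ^ 2 := by
  obtain ⟨K, hK, hWK⟩ := exists_flux_sq_le hP
  have hR := hP.R_pos
  have hN := hP.N_pos
  have hAB := sub_pos.2 hP.B_lt_A
  set w := R ^ N * (A - B) / N with hw
  have hw0 : 0 < w := by positivity
  set c := (R / 2) ^ (N - 1) / K with hc
  have hc0 : 0 < c := by positivity
  have hd : 0 < min w⁻¹ c := lt_min (inv_pos.2 hw0) hc0
  -- The integration gives `W (w⁻¹ ε² + c (R - r)) ≤ ε²`; the minimum serves as a common factor.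
  refine ⟨(min w⁻¹ c)⁻¹, inv_pos.2 hd, fun ε U hε hU r hr => ?_⟩
  have hr' : r ∈ Icc 0 R := ⟨by linarith [hr.1], hr.2⟩
  have hε2 : 0 < ε ^ 2 := by positivity
  rcases eq_or_lt_of_le (hU.flux_nonneg hP hε hr') with h0 | hpos
  · rw [← h0, zero_mul]; positivity
  have hWpos : ∀ s ∈ Icc r R, 0 < flux N R g ε U s := fun s hs =>
    hpos.trans_le (hU.monotoneOn_flux hP hε hr' ⟨hr'.1.trans hs.1, hs.2⟩ hs.1)
  have hsub : Icc r R ⊆ Icc 0 R := Icc_subset_Icc hr'.1 le_rfl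
  have h := le_of_hasDerivAt_nonneg
    (f := fun s => -(flux N R g ε U s)⁻¹ - c / ε ^ 2 * s) hr.2
    ((((hU.continuousOn_flux hP).mono hsub).inv₀ fun s hs => (hWpos s hs).ne').neg.sub
      (continuous_const.mul continuous_id).continuousOn)
    (fun s hs => (((hU.hasDerivAt_flux hP ⟨hr'.1.trans_lt hs.1, hs.2⟩).inv
      (hWpos s (Ioo_subset_Icc_self hs)).ne').neg).sub
      ((hasDerivAt_id s).const_mul (c / ε ^ 2))) fun s hs => by
      have hsI := Ioo_subset_Icc_self hs
      have hs' : s ∈ Icc 0 R := hsub hsI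
      have hW := hWpos s hsI
      have h1 := hWK ε U hε hU s hs'
      have h2 : (R / 2) ^ (N - 1) ≤ s ^ (N - 1) :=
        pow_le_pow_left₀ (by positivity) (hr.1.trans hsI.1) _
      have h3 := hU.netCharge_nonneg hP hε hs'
      have hs0 := pow_nonneg hs'.1 (N - 1)
      have h4 : c / ε ^ 2 ≤ s ^ (N - 1) * netCharge N R A B p q U s / flux N R g ε U s ^ 2 := by
        rw [div_le_div_iff₀ hε2 (by positivity), hc, div_mul_eq_mul_div, div_le_iff₀ hK]
        calc (R / 2) ^ (N - 1) * flux N R g ε U s ^ 2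
            ≤ s ^ (N - 1) * (K * ε ^ 2 * netCharge N R A B p q U s) := by gcongr
          _ = _ := by ring
      rw [neg_div, neg_neg, mul_one]
      linarith
  have hWR : flux N R g ε U R = w := hU.flux_right hP hε
  simp only [hWR] at h
  have h1 : w⁻¹ + c / ε ^ 2 * (R - r) ≤ (flux N R g ε U r)⁻¹ := by linarith
  have hRr : 0 ≤ R - r := by linarith [hr.2]
  have h2 : flux N R g ε U r * (w⁻¹ + c / ε ^ 2 * (R - r)) ≤ 1 := by
    calc _ ≤ flux N R g ε U r * (flux N R g ε U r)⁻¹ := by gcongr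
      _ = 1 := mul_inv_cancel₀ hpos.ne'
  have h3 : flux N R g ε U r * (w⁻¹ * ε ^ 2 + c * (R - r)) ≤ ε ^ 2 := by
    have := mul_le_mul_of_nonneg_right h2 hε2.le
    calc _ = flux N R g ε U r * (w⁻¹ + c / ε ^ 2 * (R - r)) * ε ^ 2 := by field_simp
      _ ≤ _ := by linarith
  rw [inv_mul_eq_div, le_div_iff₀ hd]
  calc _ = flux N R g ε U r * (min w⁻¹ c * ε ^ 2 + min w⁻¹ c * (R - r)) := by ring
    _ ≤ flux N R g ε U r * (w⁻¹ * ε ^ 2 + c * (R - r)) := by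
      gcongr
      · exact min_le_left _ _
      · exact min_le_right _ _
    _ ≤ _ := h3

/-- Since `v` is nondecreasing, the flux at the midpoint of `[r, R]` is at least `c v(r) (R - r) /
2`, while `exists_flux_le` bounds it above. -/
lemma exists_netCharge_le (hP : Admissible N R A B p q g) :
    ∃ C : ℝ, 0 < C ∧ ∀ (ε : ℝ) (U : ℝ → ℝ), 0 < ε →
      IsRadialNeumannSolution N R A B p q g ε U → ∀ r ∈ Icc 0 R,
        netCharge N R A B p q U r * (R - r) ^ 2 ≤ C * ε ^ 2 := by
  obtain ⟨C, hC, hW⟩ := exists_flux_le hP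
  have hR := hP.R_pos
  set c := (R / 2) ^ (N - 1) with hc
  have hc0 : 0 < c := by positivity
  have key : ∀ (ε : ℝ) (U : ℝ → ℝ), 0 < ε →
      IsRadialNeumannSolution N R A B p q g ε U → ∀ r ∈ Icc (R / 2) R,
        netCharge N R A B p q U r * (R - r) ^ 2 ≤ 4 * C / c * ε ^ 2 := by
    intro ε U hε hU r hr
    have hr' : r ∈ Icc 0 R := ⟨by linarith [hr.1], hr.2⟩
    set t := (r + R) / 2 with ht
    have hrt : r ≤ t := by linarith [hr.2]
    have htR : t ≤ R := by linarith [hr.2]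
    have hv := hU.netCharge_nonneg hP hε hr'
    have h := le_of_hasDerivAt_nonneg
      (f := fun s => flux N R g ε U s - c * netCharge N R A B p q U r * s) hrt
      (((hU.continuousOn_flux hP).mono (Icc_subset_Icc hr'.1 htR)).sub
        (continuous_const.mul continuous_id).continuousOn)
      (fun s hs => (hU.hasDerivAt_flux hP ⟨hr'.1.trans_lt hs.1, hs.2.trans_le htR⟩).sub
        ((hasDerivAt_id s).const_mul _)) fun s hs => by
        have hs' : s ∈ Icc 0 R := ⟨(hr'.1.trans_lt hs.1).le, hs.2.le.trans htR⟩
        have h1 := hU.monotoneOn_netCharge hP hε hr' hs' hs.1.le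
        have h2 : c ≤ s ^ (N - 1) := pow_le_pow_left₀ (by positivity) (hr.1.trans hs.1.le) _
        have : c * netCharge N R A B p q U r ≤ s ^ (N - 1) * netCharge N R A B p q U s :=
          mul_le_mul h2 h1 hv (pow_nonneg hs'.1 _)
        linarith
    have hWt := hW ε U hε hU t ⟨by linarith [hr.1], htR⟩
    have hWr := hU.flux_nonneg hP hε hr'
    have hWt0 := hU.flux_nonneg hP hε (r := t) ⟨by linarith [hr'.1], htR⟩
    have h1 : c * netCharge N R A B p q U r * ((R - r) / 2) ≤ flux N R g ε U t := by
      have : (R - r) / 2 = t - r := by rw [ht]; ring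
      rw [this]; linarith
    have hRr : 0 ≤ R - r := by linarith [hr.2]
    have h2 := mul_le_mul_of_nonneg_right h1 (show 0 ≤ (R - r) / 2 by linarith)
    have h3 : flux N R g ε U t * ((R - r) / 2) ≤ flux N R g ε U t * (ε ^ 2 + (R - t)) := by
      apply mul_le_mul_of_nonneg_left _ hWt0
      have : R - t = (R - r) / 2 := by rw [ht]; ring
      rw [this]; linarith [sq_nonneg ε]
    rw [div_mul_eq_mul_div, le_div_iff₀ hc0]
    nlinarith
  -- The outer factor `4 = (R / (R/2))²` covers `r ≤ R/2`, by comparison with `v(R/2)`.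
  refine ⟨4 * (4 * C / c), by positivity, fun ε U hε hU r hr => ?_⟩
  have hε2 : 0 < ε ^ 2 := by positivity
  rcases le_total (R / 2) r with h | h
  · refine (key ε U hε hU r ⟨h, hr.2⟩).trans ?_
    have : 0 < 4 * C / c * ε ^ 2 := by positivity
    linarith
  · have hR2 : R / 2 ∈ Icc 0 R := ⟨by linarith, by linarith⟩
    have h1 := key ε U hε hU (R / 2) ⟨le_rfl, by linarith⟩
    have h2 := hU.monotoneOn_netCharge hP hε hr hR2 h
    have h3 := hU.netCharge_nonneg hP hε hr
    have h4 : (R - r) ^ 2 ≤ R ^ 2 := pow_le_pow_left₀ (by linarith [hr.2]) (by linarith [hr.1]) 2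
    calc netCharge N R A B p q U r * (R - r) ^ 2
        ≤ netCharge N R A B p q U (R / 2) * R ^ 2 := by gcongr; exact h3.trans h2
      _ = 4 * (netCharge N R A B p q U (R / 2) * (R - R / 2) ^ 2) := by ring
      _ ≤ 4 * (4 * C / c * ε ^ 2) := by linarith
      _ = _ := by ring

/-- Integrate `W'` from the origin with `v` nondecreasing. Retaining the factor `r^(N-1)` lets it
cancel the one inside the flux, so that `U'` is controlled near the origin. -/
lemma flux_le_pow_mul (hU : IsRadialNeumannSolution N R A B p q g ε U)
    (hP : Admissible N R A B p q g) (hε : 0 < ε) {r : ℝ} (hr : r ∈ Icc 0 R) :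
    flux N R g ε U r ≤ r ^ (N - 1) * netCharge N R A B p q U r * r := by
  have hsub : Icc 0 r ⊆ Icc 0 R := Icc_subset_Icc le_rfl hr.2
  have h := le_of_hasDerivAt_nonneg
    (f := fun s => r ^ (N - 1) * netCharge N R A B p q U r * s - flux N R g ε U s) hr.1
    ((continuous_const.mul continuous_id).continuousOn.sub
      ((hU.continuousOn_flux hP).mono hsub))
    (fun s hs => ((hasDerivAt_id s).const_mul _).sub
      (hU.hasDerivAt_flux hP ⟨hs.1, hs.2.trans_le hr.2⟩)) fun s hs => by
      have hs' := hsub (Ioo_subset_Icc_self hs)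
      have h1 := hU.monotoneOn_netCharge hP hε hs' hr hs.2.le
      have h2 := hU.netCharge_nonneg hP hε hs'
      have : s ^ (N - 1) * netCharge N R A B p q U s
          ≤ r ^ (N - 1) * netCharge N R A B p q U r :=
        mul_le_mul (pow_le_pow_left₀ hs.1.le hs.2.le _) h1 h2 (pow_nonneg hr.1 _)
      linarith
  simp only [hU.flux_zero] at h
  linarith

/-- On `[R/2, R]`, divide the flux bound by its nondegenerate weight. On `[0, R/2]`, `ε² g U' ≤ r v
= O(ε²)`, so `U'` is bounded. -/
lemma exists_rDeriv_le (hP : Admissible N R A B p q g) :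
    ∃ C : ℝ, 0 < C ∧ ∀ (ε : ℝ) (U : ℝ → ℝ), 0 < ε → ε ≤ 1 →
      IsRadialNeumannSolution N R A B p q g ε U → ∀ r ∈ Icc 0 R,
        rDeriv R U r * (ε ^ 2 + (R - r)) ≤ C := by
  obtain ⟨g₀, g₁, hg₀, hg₁, hg⟩ := hP.exists_bounds
  obtain ⟨C₁, hC₁, hW⟩ := exists_flux_le hP
  obtain ⟨C₂, hC₂, hv⟩ := exists_netCharge_le hP
  have hR := hP.R_pos
  set c := (R / 2) ^ (N - 1) * g₀ with hc
  have hc0 : 0 < c := by positivity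
  refine ⟨C₁ / c + 4 * C₂ / (R * g₀) * (1 + R), by positivity, fun ε U hε hε1 hU r hr => ?_⟩
  have hε2 : 0 < ε ^ 2 := by positivity
  have hd := hU.rDeriv_nonneg hP hε hr
  have hgr := (hg r hr).1
  have hx : 0 ≤ R - r := by linarith [hr.2]
  have hp1 : 0 < C₁ / c := by positivity
  have hp2 : 0 < 4 * C₂ / (R * g₀) * (1 + R) := by positivity
  rcases le_total (R / 2) r with h | h
  · have h1 := hW ε U hε hU r ⟨h, hr.2⟩
    have h2 : ε ^ 2 * (c * rDeriv R U r) ≤ flux N R g ε U r := by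
      unfold flux
      have : c ≤ r ^ (N - 1) * g r := mul_le_mul (pow_le_pow_left₀ (by positivity) h _) hgr
        hg₀.le (pow_nonneg hr.1 _)
      gcongr
    have h3 : ε ^ 2 * (c * rDeriv R U r * (ε ^ 2 + (R - r))) ≤ ε ^ 2 * C₁ := by
      calc _ = ε ^ 2 * (c * rDeriv R U r) * (ε ^ 2 + (R - r)) := by ring
        _ ≤ flux N R g ε U r * (ε ^ 2 + (R - r)) := by gcongr
        _ ≤ _ := by linarith
    have h4 := le_of_mul_le_mul_left h3 hε2
    have : rDeriv R U r * (ε ^ 2 + (R - r)) ≤ C₁ / c := by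
      rw [le_div_iff₀ hc0]; linarith
    linarith
  · rcases eq_or_lt_of_le hr.1 with h0 | h0
    · rw [← h0, hU.deriv_zero, zero_mul]; positivity
    have hR2 : R / 2 ∈ Icc 0 R := ⟨by linarith, by linarith⟩
    have h1 := hU.flux_le_pow_mul hP hε hr
    have h2 := hv ε U hε hU (R / 2) hR2
    have h3 := hU.monotoneOn_netCharge hP hε hr hR2 h
    have h4 : ε ^ 2 * (g r * rDeriv R U r) ≤ netCharge N R A B p q U r * r := by
      have hrp : 0 < r ^ (N - 1) := pow_pos h0 _
      refine le_of_mul_le_mul_left ?_ hrp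
      unfold flux at h1
      linarith
    have h5 : ε ^ 2 * (g₀ * rDeriv R U r) ≤ ε ^ 2 * (g r * rDeriv R U r) := by gcongr
    have h6 : netCharge N R A B p q U r * r ≤ netCharge N R A B p q U (R / 2) * R :=
      mul_le_mul h3 hr.2 hr.1 (hU.netCharge_nonneg hP hε hR2)
    have h7 : netCharge N R A B p q U (R / 2) * R * R ≤ 4 * C₂ * ε ^ 2 := by nlinarith
    have h8 : rDeriv R U r ≤ 4 * C₂ / (R * g₀) := by
      rw [le_div_iff₀ (by positivity)]
      refine le_of_mul_le_mul_left ?_ hε2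
      have := mul_le_mul_of_nonneg_right (h5.trans (h4.trans h6)) hR.le
      nlinarith
    have h9 : ε ^ 2 + (R - r) ≤ 1 + R := by nlinarith [hr.1]
    have : rDeriv R U r * (ε ^ 2 + (R - r)) ≤ 4 * C₂ / (R * g₀) * (1 + R) := by gcongr
    linarith

end IsRadialNeumannSolution

end

end CCPB

/-! ### Potential energy and its approximate balance with the squared gradient. -/

namespace CCPB

noncomputable section

variable {N : ℕ} {R A B p q ε : ℝ} {g U : ℝ → ℝ}

/-- The potential energy `∫ netCharge dU`, normalised to vanish at the origin. -/
def energy (N : ℕ) (R A B p q : ℝ) (U : ℝ → ℝ) (r : ℝ) : ℝ :=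
  coef N R A p U / p * (Real.exp (p * U r) - Real.exp (p * U 0))
    + coef N R B (-q) U / q * (Real.exp (-q * U r) - Real.exp (-q * U 0))

/-- This isolates `v / p`, the only part that concentrates; the rest consists of a value at the
origin and bounded exponentials. -/
lemma energy_eq (hP : Admissible N R A B p q g) (r : ℝ) :
    energy N R A B p q U r = (netCharge N R A B p q U r - netCharge N R A B p q U 0) / p
      + coef N R B (-q) U * (1 / p + 1 / q) * (Real.exp (-q * U r) - Real.exp (-q * U 0)) := by
  have := hP.p_pos.ne'
  have := hP.q_pos.ne'
  unfold energy netCharge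
  field_simp
  ring

namespace IsRadialNeumannSolution

lemma continuousOn_energy (hU : IsRadialNeumannSolution N R A B p q g ε U) :
    ContinuousOn (energy N R A B p q U) (Icc 0 R) :=
  (((hU.continuousOn_exp p).sub continuousOn_const).const_mul _).add
    (((hU.continuousOn_exp (-q)).sub continuousOn_const).const_mul _)

lemma hasDerivAt_energy (hU : IsRadialNeumannSolution N R A B p q g ε U)
    (hP : Admissible N R A B p q g) {r : ℝ} (hr : r ∈ Ioo 0 R) :
    HasDerivAt (energy N R A B p q U) (netCharge N R A B p q U r * rDeriv R U r) r := by
  have := hP.p_pos.ne'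
  have := hP.q_pos.ne'
  refine ((((hU.hasDerivAt_exp p hr).sub_const _).const_mul _).add
    (((hU.hasDerivAt_exp (-q) hr).sub_const _).const_mul _)).congr_deriv ?_
  unfold netCharge
  field_simp
  ring

lemma energy_nonneg (hU : IsRadialNeumannSolution N R A B p q g ε U)
    (hP : Admissible N R A B p q g) (hε : 0 < ε) {r : ℝ} (hr : r ∈ Icc 0 R) :
    0 ≤ energy N R A B p q U r := by
  have hsub : Icc 0 r ⊆ Icc 0 R := Icc_subset_Icc le_rfl hr.2
  have h := le_of_hasDerivAt_nonneg hr.1 (hU.continuousOn_energy.mono hsub)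
    (fun s hs => hU.hasDerivAt_energy hP ⟨hs.1, hs.2.trans_le hr.2⟩) fun s hs =>
      mul_nonneg (hU.netCharge_nonneg hP hε (hsub (Ioo_subset_Icc_self hs)))
        (hU.rDeriv_nonneg hP hε (hsub (Ioo_subset_Icc_self hs)))
  simpa [energy] using h

lemma energy_le (hU : IsRadialNeumannSolution N R A B p q g ε U)
    (hP : Admissible N R A B p q g) (hε : 0 < ε) {r : ℝ} (hr : r ∈ Icc 0 R) :
    energy N R A B p q U r ≤ netCharge N R A B p q U r / p := by
  have hsub : Icc 0 r ⊆ Icc 0 R := Icc_subset_Icc le_rfl hr.2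
  have hp := hP.p_pos
  have h := le_of_hasDerivAt_nonneg
    (f := fun s => netCharge N R A B p q U s / p - energy N R A B p q U s) hr.1
    (((hU.continuousOn_netCharge.div_const p).sub hU.continuousOn_energy).mono hsub)
    (fun s hs => ((hU.hasDerivAt_netCharge ⟨hs.1, hs.2.trans_le hr.2⟩).div_const p).sub
      (hU.hasDerivAt_energy hP ⟨hs.1, hs.2.trans_le hr.2⟩)) fun s hs => by
      have h1 := hU.mul_netCharge_le_deriv hP hε (hsub (Ioo_subset_Icc_self hs))
      rw [sub_nonneg, le_div_iff₀ hp]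
      linarith
  have h0 := div_nonneg (hU.netCharge_nonneg hP hε (r := 0) ⟨le_rfl, hP.R_pos.le⟩) hp.le
  have : energy N R A B p q U 0 = 0 := by simp [energy]
  rw [this] at h
  linarith

/-- Since `(W² / (2ε²))' = s^(2(N-1)) g E'` with `E` the energy, differentiating the difference
leaves only `-(s^(2(N-1)) g)' E`. As `0 ≤ E ≤ v / p`, this is at most a multiple of `s^(N-1) v =
W'`, and integrates to a multiple of `W`. -/
lemma exists_energy_balance (hP : Admissible N R A B p q g) :
    ∃ C : ℝ, 0 < C ∧ ∀ (ε : ℝ) (U : ℝ → ℝ), 0 < ε →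
      IsRadialNeumannSolution N R A B p q g ε U → ∀ r ∈ Icc 0 R,
        |flux N R g ε U r ^ 2 / (2 * ε ^ 2)
          - (r ^ (N - 1)) ^ 2 * g r * energy N R A B p q U r| ≤ C * flux N R g ε U r := by
  obtain ⟨g₀, g₁, hg₀, hg₁, hg⟩ := hP.exists_bounds
  have hR := hP.R_pos
  have hp := hP.p_pos
  set L := 2 * (N - 1 : ℕ) * R ^ (N - 1 - 1) * g₁ + R ^ (N - 1) * g₁ with hL
  have hL0 : 0 < L := by positivity
  refine ⟨L / p, by positivity, fun ε U hε hU r hr => ?_⟩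
  have hsub : Icc 0 r ⊆ Icc 0 R := Icc_subset_Icc le_rfl hr.2
  set H : ℝ → ℝ := fun s => flux N R g ε U s ^ 2 / (2 * ε ^ 2)
    - (s ^ (N - 1)) ^ 2 * g s * energy N R A B p q U s with hH
  set G' : ℝ → ℝ := fun s =>
    2 * s ^ (N - 1) * ((N - 1 : ℕ) * s ^ (N - 1 - 1)) * g s
      + (s ^ (N - 1)) ^ 2 * rDeriv R g s with hG'
  have hHc : ContinuousOn H (Icc 0 r) := by
    refine ContinuousOn.mono ?_ hsub
    exact (((hU.continuousOn_flux hP).pow 2).div_const _).sub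
      (((((continuous_pow _).pow 2).continuousOn).mul hP.smooth.continuousOn).mul
        hU.continuousOn_energy)
  have hHd : ∀ s ∈ Ioo 0 r, HasDerivAt H (-(G' s * energy N R A B p q U s)) s := by
    intro s hs
    have hs' : s ∈ Ioo 0 R := ⟨hs.1, hs.2.trans_le hr.2⟩
    have h1 := ((hU.hasDerivAt_flux hP hs').pow 2).div_const (2 * ε ^ 2)
    have h2 := ((((hasDerivAt_pow (N - 1) s).pow 2).mul
      (hasDerivAt_rDeriv hP.contDiffOn_one hs')).mul (hU.hasDerivAt_energy hP hs'))
    refine (h1.sub h2).congr_deriv ?_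
    simp only [hG', flux, Pi.mul_apply, Pi.pow_apply]
    norm_num
    field_simp
    ring
  have hbound : ∀ s ∈ Ioo 0 r, |G' s * energy N R A B p q U s|
      ≤ L / p * (s ^ (N - 1) * netCharge N R A B p q U s) := by
    intro s hs
    have hs' := hsub (Ioo_subset_Icc_self hs)
    obtain ⟨-, h1, h2⟩ := hg s hs'
    have hs0 : 0 ≤ s := hs'.1
    have h3 := hU.energy_nonneg hP hε hs'
    have h4 := hU.energy_le hP hε hs'
    have h5 := hU.netCharge_nonneg hP hε hs'
    -- Exactly one factor `s^(N-1)` is extracted, to match `W' = s^(N-1) v`.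
    have h6 : |G' s| ≤ s ^ (N - 1) * L := by
      calc |G' s| ≤ |2 * s ^ (N - 1) * ((N - 1 : ℕ) * s ^ (N - 1 - 1)) * g s|
            + |(s ^ (N - 1)) ^ 2 * rDeriv R g s| := abs_add_le _ _
        _ = 2 * s ^ (N - 1) * ((N - 1 : ℕ) * s ^ (N - 1 - 1)) * g s
            + (s ^ (N - 1)) ^ 2 * |rDeriv R g s| := by
          rw [abs_of_nonneg, abs_mul, abs_of_nonneg (sq_nonneg (s ^ (N - 1)))]
          exact mul_nonneg (by positivity) (hP.g_pos s hs').le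
        _ = s ^ (N - 1) * (2 * (N - 1 : ℕ) * s ^ (N - 1 - 1) * g s
            + s ^ (N - 1) * |rDeriv R g s|) := by ring
        _ ≤ s ^ (N - 1) * L := by
          have hgs := (hP.g_pos s hs').le
          have e1 : s ^ (N - 1 - 1) * g s ≤ R ^ (N - 1 - 1) * g₁ :=
            mul_le_mul (pow_le_pow_left₀ hs0 hs'.2 _) h1 hgs (by positivity)
          have e2 : s ^ (N - 1) * |rDeriv R g s| ≤ R ^ (N - 1) * g₁ :=
            mul_le_mul (pow_le_pow_left₀ hs0 hs'.2 _) h2 (abs_nonneg _) (by positivity)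
          have e3 := mul_le_mul_of_nonneg_left e1 (show (0 : ℝ) ≤ 2 * (N - 1 : ℕ) by positivity)
          apply mul_le_mul_of_nonneg_left _ (by positivity)
          rw [hL]
          linarith
    rw [abs_mul, abs_of_nonneg h3]
    calc _ ≤ s ^ (N - 1) * L * (netCharge N R A B p q U s / p) :=
          mul_le_mul h6 h4 h3 (by positivity)
      _ = _ := by ring
  have hH0 : H 0 = 0 := by simp [hH, hU.flux_zero, energy]
  have hWc := (hU.continuousOn_flux hP).mono hsub
  have hWd : ∀ s ∈ Ioo 0 r, HasDerivAt (flux N R g ε U) (s ^ (N - 1) * netCharge N R A B p q U s) s :=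
    fun s hs => hU.hasDerivAt_flux hP ⟨hs.1, hs.2.trans_le hr.2⟩
  have h1 := le_of_hasDerivAt_nonneg (f := fun s => L / p * flux N R g ε U s - H s) hr.1
    ((hWc.const_mul _).sub hHc) (fun s hs => ((hWd s hs).const_mul _).sub (hHd s hs))
    fun s hs => by linarith [(abs_le.1 (hbound s hs)).1]
  have h2 := le_of_hasDerivAt_nonneg (f := fun s => L / p * flux N R g ε U s + H s) hr.1
    ((hWc.const_mul _).add hHc) (fun s hs => ((hWd s hs).const_mul _).add (hHd s hs))
    fun s hs => by linarith [(abs_le.1 (hbound s hs)).2]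
  simp only [hH0, hU.flux_zero] at h1 h2
  exact abs_le.2 ⟨by linarith, by linarith⟩

end IsRadialNeumannSolution

end

end CCPB

/-! ### Concentration at `R`, and limits of the potential and the coefficients. -/

namespace CCPB

noncomputable section

variable {N : ℕ} {R A B p q : ℝ} {g : ℝ → ℝ}

lemma eventually_pos : ∀ᶠ ε in 𝓝[>] (0 : ℝ), 0 < ε := self_mem_nhdsWithin

lemma eventually_pos_le_one : ∀ᶠ ε in 𝓝[>] (0 : ℝ), 0 < ε ∧ ε ≤ 1 := by
  filter_upwards [Ioc_mem_nhdsGT (zero_lt_one (α := ℝ))] with ε hε using hε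

lemma ae_mem_uIoc_imp_mem_Ioo (hR : 0 < R) : ∀ᵐ x : ℝ, x ∈ uIoc 0 R → x ∈ Ioo 0 R := by
  have : ∀ᵐ x : ℝ, x ≠ R := by simp [ae_iff]
  filter_upwards [this] with x hx hx'
  rw [uIoc_of_le hR.le] at hx'
  exact ⟨hx'.1, lt_of_le_of_ne hx'.2 hx⟩

lemma aestronglyMeasurable_uIoc {f : ℝ → ℝ} (hR : 0 < R) (hf : ContinuousOn f (Icc 0 R)) :
    AEStronglyMeasurable f (volume.restrict (uIoc 0 R)) := by
  rw [uIoc_of_le hR.le]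
  exact (hf.mono Ioc_subset_Icc_self).aestronglyMeasurable measurableSet_Ioc

lemma exists_abs_le {f : ℝ → ℝ} (hf : ContinuousOn f (Icc 0 R)) :
    ∃ M : ℝ, 0 < M ∧ ∀ r ∈ Icc 0 R, |f r| ≤ M := by
  obtain ⟨M, hM⟩ := isCompact_Icc.exists_bound_of_continuousOn hf
  exact ⟨max M 1, lt_max_of_lt_right one_pos, fun r hr => le_max_of_le_left (hM r hr)⟩

lemma tendsto_integral_mul_of_bounded {D : ℝ → ℝ → ℝ} {h : ℝ → ℝ} {C : ℝ} (hR : 0 < R)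
    (hh : ContinuousOn h (Icc 0 R)) (hD : ∀ᶠ ε in 𝓝[>] (0 : ℝ), ContinuousOn (D ε) (Icc 0 R))
    (hb : ∀ᶠ ε in 𝓝[>] (0 : ℝ), ∀ r ∈ Ioo 0 R, |D ε r| ≤ C)
    (hl : ∀ r ∈ Ioo 0 R, Tendsto (fun ε => D ε r) (𝓝[>] 0) (𝓝 0)) :
    Tendsto (fun ε => ∫ r in (0 : ℝ)..R, h r * D ε r) (𝓝[>] 0) (𝓝 0) := by
  obtain ⟨M, hM, hhM⟩ := exists_abs_le hh
  suffices hlim : Tendsto (fun ε => ∫ r in (0 : ℝ)..R, h r * D ε r) (𝓝[>] 0)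
      (𝓝 (∫ r in (0 : ℝ)..R, (0 : ℝ))) by simpa using hlim
  refine intervalIntegral.tendsto_integral_filter_of_dominated_convergence (fun _ => M * C)
    ?_ ?_ intervalIntegrable_const ?_
  · filter_upwards [hD] with ε hε
    exact aestronglyMeasurable_uIoc hR (hh.mul hε)
  · filter_upwards [hb] with ε hε
    filter_upwards [ae_mem_uIoc_imp_mem_Ioo hR] with r hr hr'
    rw [norm_mul]
    exact mul_le_mul (hhM r (Ioo_subset_Icc_self (hr hr'))) (hε r (hr hr')) (abs_nonneg _) hM.le
  · filter_upwards [ae_mem_uIoc_imp_mem_Ioo hR] with r hr hr'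
    simpa using (hl r (hr hr')).const_mul (h r)

/-- Nonnegative monotone densities of constant weighted mass that vanish in the limit inside the
interval concentrate at its right end. -/
lemma tendsto_integral_of_concentrating {f : ℝ → ℝ → ℝ} {h : ℝ → ℝ} {n : ℕ} {m : ℝ} (hR : 0 < R)
    (hc : ∀ ε, 0 < ε → ContinuousOn (f ε) (Icc 0 R))
    (h0 : ∀ ε, 0 < ε → ∀ r ∈ Icc 0 R, 0 ≤ f ε r)
    (hmono : ∀ ε, 0 < ε → MonotoneOn (f ε) (Icc 0 R))
    (hm : ∀ ε, 0 < ε → ∫ s in (0 : ℝ)..R, s ^ n * f ε s = m)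
    (hl : ∀ r ∈ Ico 0 R, Tendsto (fun ε => f ε r) (𝓝[>] 0) (𝓝 0))
    (hh : ContinuousOn h (Icc 0 R)) :
    Tendsto (fun ε => ∫ r in (0 : ℝ)..R, h r * f ε r) (𝓝[>] 0) (𝓝 (m / R ^ n * h R)) := by
  -- Subtracting the multiple of `s^n` that agrees with `h` at `R` leaves a test function vanishing
  -- there; the subtracted part integrates exactly by the mass condition.
  set k : ℝ → ℝ := fun s => h s - h R / R ^ n * s ^ n with hk
  have hkc : ContinuousOn k (Icc 0 R) :=
    hh.sub (continuous_const.mul (continuous_pow n)).continuousOn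
  have hkR : k R = 0 := by
    have : R ^ n ≠ 0 := (pow_pos hR n).ne'
    simp only [hk]; field_simp; simp
  obtain ⟨M, hM, hkM⟩ := exists_abs_le hkc
  have hint : ∀ {u v : ℝ → ℝ}, ContinuousOn u (Icc 0 R) → ContinuousOn v (Icc 0 R) →
      IntervalIntegrable (fun r => u r * v r) volume 0 R := fun hu hv => by
    apply ContinuousOn.intervalIntegrable
    rw [uIcc_of_le hR.le]
    exact hu.mul hv
  have hpc : ContinuousOn (fun s : ℝ => s ^ n) (Icc 0 R) := (continuous_pow n).continuousOn
  have hsplit : ∀ ε, 0 < ε → ∫ r in (0 : ℝ)..R, h r * f ε r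
      = (∫ r in (0 : ℝ)..R, k r * f ε r) + m / R ^ n * h R := by
    intro ε hε
    have : ∀ r, h r * f ε r = k r * f ε r + h R / R ^ n * (r ^ n * f ε r) := fun r => by
      simp only [hk]; ring
    simp only [this]
    rw [intervalIntegral.integral_add (hint hkc (hc ε hε))
      ((hint hpc (hc ε hε)).const_mul _), intervalIntegral.integral_const_mul, hm ε hε]
    ring
  suffices hk0 : Tendsto (fun ε => ∫ r in (0 : ℝ)..R, k r * f ε r) (𝓝[>] 0) (𝓝 0) by
    have := hk0.add_const (m / R ^ n * h R)
    rw [zero_add] at this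
    refine this.congr' ?_
    filter_upwards [eventually_pos] with ε hε using (hsplit ε hε).symm
  have hm0 : 0 ≤ m := by
    rw [← hm 1 one_pos]
    exact intervalIntegral.integral_nonneg hR.le fun s hs =>
      mul_nonneg (pow_nonneg hs.1 _) (h0 1 one_pos s hs)
  rw [Metric.tendsto_nhds]
  intro η hη
  set c := (R / 2) ^ n with hcdef
  have hc0 : 0 < c := by positivity
  -- Chosen so that the part near `R` contributes at most `η' m / c < η / 2`; the `+ 1` allows `m =
  -- 0`.
  set η' := η * c / (2 * (m + 1)) with hη'
  have hη0 : 0 < η' := by positivity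
  have hnear : ∀ᶠ s in 𝓝[Icc 0 R] R, |k s| < η' := by
    have h1 := (hkc R ⟨hR.le, le_rfl⟩).abs
    rw [ContinuousWithinAt, hkR, abs_zero] at h1
    exact h1.eventually (gt_mem_nhds hη0)
  obtain ⟨δ, hδ, hδk⟩ := Metric.mem_nhdsWithin_iff.1 hnear
  -- Beyond `r₀` both `|k| < η'` and `s^n ≥ c` hold; before it, monotonicity bounds `f ε` by its
  -- value at `r₀`.
  set r₀ := max (R / 2) (R - δ / 2) with hr₀
  have hr₀R : r₀ < R := max_lt (by linarith) (by linarith)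
  have hr₀0 : R / 2 ≤ r₀ := le_max_left _ _
  have hfar := (hl r₀ ⟨by linarith, hr₀R⟩).eventually
    (gt_mem_nhds (show 0 < η / (2 * (R * M)) by positivity))
  filter_upwards [hfar, eventually_pos] with ε hε hεpos
  have hr₀I : r₀ ∈ Icc 0 R := ⟨by linarith, hr₀R.le⟩
  have hpt : ∀ s ∈ Icc 0 R, ‖k s * f ε s‖ ≤ η' / c * (s ^ n * f ε s) + M * f ε r₀ := by
    intro s hs
    have hf := h0 ε hεpos s hs
    rw [norm_mul, Real.norm_eq_abs, Real.norm_eq_abs, abs_of_nonneg hf]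
    have hf0 := h0 ε hεpos r₀ hr₀I
    have hs0 := pow_nonneg hs.1 n
    rcases le_total s r₀ with hsr | hsr
    · have h1 := hmono ε hεpos hs hr₀I hsr
      have h2 : |k s| * f ε s ≤ M * f ε r₀ := mul_le_mul (hkM s hs) h1 hf hM.le
      have h3 : 0 ≤ η' / c * (s ^ n * f ε s) := by positivity
      linarith
    · have h1 : |k s| < η' := hδk ⟨by
        rw [Metric.mem_ball, Real.dist_eq, abs_lt]
        have := le_max_right (R / 2) (R - δ / 2)
        constructor <;> linarith [hs.2], hs⟩
      have h2 : c ≤ s ^ n := pow_le_pow_left₀ (by positivity) (hr₀0.trans hsr) _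
      have h3 : η' ≤ η' / c * s ^ n := by
        rw [div_mul_eq_mul_div, le_div_iff₀ hc0]; gcongr
      have h4 : |k s| * f ε s ≤ η' / c * s ^ n * f ε s :=
        mul_le_mul_of_nonneg_right (h1.le.trans h3) hf
      have h5 : 0 ≤ M * f ε r₀ := by positivity
      linarith
  rw [dist_zero_right]
  have hle : ‖∫ r in (0 : ℝ)..R, k r * f ε r‖
      ≤ ∫ s in (0 : ℝ)..R, (η' / c * (s ^ n * f ε s) + M * f ε r₀) := by
    refine intervalIntegral.norm_integral_le_of_norm_le hR.le ?_
      (((hint hpc (hc ε hεpos)).const_mul _).add intervalIntegrable_const)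
    filter_upwards with s hs using hpt s (Ioc_subset_Icc_self hs)
  rw [intervalIntegral.integral_add ((hint hpc (hc ε hεpos)).const_mul _)
    intervalIntegrable_const, intervalIntegral.integral_const_mul, hm ε hεpos,
    intervalIntegral.integral_const, smul_eq_mul, sub_zero] at hle
  have h1 : η' / c * m < η / 2 := by
    have : η' / c * m = η / 2 * (m / (m + 1)) := by rw [hη']; field_simp
    rw [this]
    have : m / (m + 1) < 1 := by rw [div_lt_one (by linarith)]; linarith
    nlinarith
  have h2 : R * (M * f ε r₀) < η / 2 := by
    rw [lt_div_iff₀ (by positivity)] at hε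
    linarith
  linarith

namespace IsRadialNeumannSolution

variable {U : ℝ → ℝ → ℝ}

lemma tendsto_netCharge (hP : Admissible N R A B p q g)
    (hU : ∀ ε, 0 < ε → IsRadialNeumannSolution N R A B p q g ε (U ε)) {r : ℝ} (hr : r ∈ Ico 0 R) :
    Tendsto (fun ε => netCharge N R A B p q (U ε) r) (𝓝[>] 0) (𝓝 0) := by
  obtain ⟨C, hC, hv⟩ := exists_netCharge_le hP
  have hrI : r ∈ Icc 0 R := Ico_subset_Icc_self hr
  have hx : 0 < (R - r) ^ 2 := pow_pos (sub_pos.2 hr.2) 2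
  have hlim : Tendsto (fun ε : ℝ => C * ε ^ 2 / (R - r) ^ 2) (𝓝[>] 0) (𝓝 0) := by
    have : Continuous fun ε : ℝ => C * ε ^ 2 / (R - r) ^ 2 := by fun_prop
    have h := this.tendsto 0
    simp only [ne_eq, OfNat.ofNat_ne_zero, not_false_eq_true, zero_pow, mul_zero, zero_div] at h
    exact h.mono_left nhdsWithin_le_nhds
  refine squeeze_zero' ?_ ?_ hlim
  · filter_upwards [eventually_pos] with ε hε using (hU ε hε).netCharge_nonneg hP hε hrI
  · filter_upwards [eventually_pos] with ε hε
    rw [le_div_iff₀ hx]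
    exact hv ε _ hε (hU ε hε) r hrI

lemma tendsto_value_sub (hP : Admissible N R A B p q g)
    (hU : ∀ ε, 0 < ε → IsRadialNeumannSolution N R A B p q g ε (U ε)) {r : ℝ} (hr : r ∈ Ico 0 R) :
    Tendsto (fun ε => U ε r - U ε 0) (𝓝[>] 0) (𝓝 0) := by
  have hpB : 0 < p * B := mul_pos hP.p_pos hP.B_pos
  have hrI : r ∈ Icc 0 R := Ico_subset_Icc_self hr
  have hlim := (tendsto_netCharge hP hU hr).div_const (p * B)
  rw [zero_div] at hlim
  refine squeeze_zero' ?_ ?_ hlim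
  · filter_upwards [eventually_pos] with ε hε
    exact sub_nonneg.2 ((hU ε hε).monotoneOn hP hε ⟨le_rfl, hP.R_pos.le⟩ hrI hr.1)
  · filter_upwards [eventually_pos] with ε hε
    rw [le_div_iff₀ hpB, mul_comm]
    exact (hU ε hε).value_sub_le hP hε hrI

/-- Integrating `U' ≤ C / (R - r)` produces an integrable majorant independent of `ε`, as dominated
convergence requires. -/
lemma exists_value_sub_le_log (hP : Admissible N R A B p q g) :
    ∃ C : ℝ, 0 < C ∧ ∀ (ε : ℝ) (U : ℝ → ℝ), 0 < ε → ε ≤ 1 →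
      IsRadialNeumannSolution N R A B p q g ε U → ∀ r ∈ Ico 0 R,
        U r - U 0 ≤ C * (Real.log R - Real.log (R - r)) := by
  obtain ⟨C, hC, hd⟩ := exists_rDeriv_le hP
  refine ⟨C, hC, fun ε U hε hε1 hU r hr => ?_⟩
  have hsub : Icc 0 r ⊆ Icc 0 R := Icc_subset_Icc le_rfl hr.2.le
  have h := le_of_hasDerivAt_nonneg (f := fun s => -(C * Real.log (R - s)) - U s) hr.1
    ((ContinuousOn.const_mul (ContinuousOn.log (by fun_prop) fun s hs =>
      (sub_pos.2 (hs.2.trans_lt hr.2)).ne') C).neg.sub (hU.continuousOn.mono hsub))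
    (fun s hs => (((((hasDerivAt_id s).const_sub R).log
      (sub_pos.2 (hs.2.trans hr.2)).ne').const_mul C).neg).sub
        (hU.hasDerivAt ⟨hs.1, hs.2.trans hr.2⟩)) fun s hs => by
      have hs' := hsub (Ioo_subset_Icc_self hs)
      have hx : 0 < R - s := sub_pos.2 (hs.2.trans hr.2)
      have h1 := hd ε U hε hε1 hU s hs'
      have h2 := hU.rDeriv_nonneg hP hε hs'
      have h3 : rDeriv R U s ≤ C / (R - s) := by
        rw [le_div_iff₀ hx]
        nlinarith [mul_nonneg h2 (sq_nonneg ε)]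
      have h4 : -(C * (-1 / (R - s))) = C / (R - s) := by ring
      simp only [id]
      rw [h4]
      linarith
  simp only [sub_zero] at h
  linarith

/-- The weighted mean of `U - U(0)` is `-U(0)` by the mean-zero condition, and it tends to zero by
dominated convergence with the logarithmic majorant. -/
lemma tendsto_value_zero (hP : Admissible N R A B p q g)
    (hU : ∀ ε, 0 < ε → IsRadialNeumannSolution N R A B p q g ε (U ε)) :
    Tendsto (fun ε => U ε 0) (𝓝[>] 0) (𝓝 0) := by
  obtain ⟨C, hC, hlog⟩ := exists_value_sub_le_log hP
  have hR := hP.R_pos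
  have hlim : Tendsto (fun ε => ∫ s in (0 : ℝ)..R, s ^ (N - 1) * (U ε s - U ε 0)) (𝓝[>] 0)
      (𝓝 (∫ s in (0 : ℝ)..R, (0 : ℝ))) := by
    refine intervalIntegral.tendsto_integral_filter_of_dominated_convergence
      (fun s => R ^ (N - 1) * (C * (Real.log R - Real.log (R - s)))) ?_ ?_ ?_ ?_
    · filter_upwards [eventually_pos] with ε hε
      exact aestronglyMeasurable_uIoc hR ((continuous_pow _).continuousOn.mul
        ((hU ε hε).continuousOn.sub continuousOn_const))
    · filter_upwards [eventually_pos_le_one] with ε hε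
      filter_upwards [ae_mem_uIoc_imp_mem_Ioo hR] with s hs hs'
      have hsI := hs hs'
      have h1 := hlog ε _ hε.1 hε.2 (hU ε hε.1) s ⟨hsI.1.le, hsI.2⟩
      have h2 := sub_nonneg.2 ((hU ε hε.1).monotoneOn hP hε.1 ⟨le_rfl, hR.le⟩
        (Ioo_subset_Icc_self hsI) hsI.1.le)
      rw [Real.norm_of_nonneg (mul_nonneg (pow_nonneg hsI.1.le _) h2)]
      exact mul_le_mul (pow_le_pow_left₀ hsI.1.le hsI.2.le _) h1 h2 (by positivity)
    · have h := (intervalIntegral.intervalIntegrable_log' (a := R) (b := 0)).comp_sub_left R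
      simp only [sub_self, sub_zero] at h
      exact ((intervalIntegrable_const.sub h).const_mul C).const_mul _
    · filter_upwards [ae_mem_uIoc_imp_mem_Ioo hR] with s hs hs'
      simpa using (tendsto_value_sub hP hU ⟨(hs hs').1.le, (hs hs').2⟩).const_mul (s ^ (N - 1))
  have hm := mass_pos hP
  have hval : ∀ ε, 0 < ε → -((∫ s in (0 : ℝ)..R, s ^ (N - 1) * (U ε s - U ε 0)) / (R ^ N / N))
      = U ε 0 := by
    intro ε hε
    have i1 : IntervalIntegrable (fun s => s ^ (N - 1) * U ε s) volume 0 R := by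
      apply ContinuousOn.intervalIntegrable
      rw [uIcc_of_le hR.le]
      exact (continuous_pow _).continuousOn.mul (hU ε hε).continuousOn
    have i2 : IntervalIntegrable (fun s : ℝ => s ^ (N - 1) * U ε 0) volume 0 R :=
      ((continuous_pow _).mul continuous_const).intervalIntegrable _ _
    simp only [mul_sub]
    rw [intervalIntegral.integral_sub i1 i2, (hU ε hε).mean_zero,
      intervalIntegral.integral_mul_const, integral_weight hP, zero_sub, neg_div, neg_neg,
      mul_div_cancel_left₀ _ hm.ne']
  have h2 := (hlim.div_const (R ^ N / N)).neg
  simp only [intervalIntegral.integral_zero, zero_div, neg_zero] at h2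
  refine h2.congr' ?_
  filter_upwards [eventually_pos] with ε hε using hval ε hε

lemma tendsto_value (hP : Admissible N R A B p q g)
    (hU : ∀ ε, 0 < ε → IsRadialNeumannSolution N R A B p q g ε (U ε)) {r : ℝ} (hr : r ∈ Ico 0 R) :
    Tendsto (fun ε => U ε r) (𝓝[>] 0) (𝓝 0) := by
  simpa using (tendsto_value_sub hP hU hr).add (tendsto_value_zero hP hU)

lemma tendsto_exp (hP : Admissible N R A B p q g)
    (hU : ∀ ε, 0 < ε → IsRadialNeumannSolution N R A B p q g ε (U ε)) (c : ℝ) {r : ℝ}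
    (hr : r ∈ Ico 0 R) : Tendsto (fun ε => Real.exp (c * U ε r)) (𝓝[>] 0) (𝓝 1) := by
  have h := ((tendsto_value hP hU hr).const_mul c).rexp
  simpa using h

lemma exists_abs_exp_neg_sub_one_le (hP : Admissible N R A B p q g) :
    ∃ M : ℝ, 0 < M ∧ ∀ (ε : ℝ) (U : ℝ → ℝ), 0 < ε →
      IsRadialNeumannSolution N R A B p q g ε U → ∀ r ∈ Icc 0 R,
        |Real.exp (-q * U r) - 1| ≤ M := by
  refine ⟨Real.exp (-q * (Real.log (B / A) / p)) + 1, by positivity, fun ε U hε hU r hr => ?_⟩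
  have h1 := hU.exp_neg_le hP hε hr
  have h2 := Real.exp_pos (-q * U r)
  exact abs_le.2 ⟨by linarith, by linarith⟩

lemma tendsto_expMass_neg (hP : Admissible N R A B p q g)
    (hU : ∀ ε, 0 < ε → IsRadialNeumannSolution N R A B p q g ε (U ε)) :
    Tendsto (fun ε => expMass N R (-q) (U ε)) (𝓝[>] 0) (𝓝 (R ^ N / N)) := by
  obtain ⟨M, hM, hb⟩ := exists_abs_exp_neg_sub_one_le hP
  have hR := hP.R_pos
  have hlim := tendsto_integral_mul_of_bounded (D := fun ε r => Real.exp (-q * U ε r) - 1)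
    (h := fun s => s ^ (N - 1)) (C := M) hR (continuous_pow _).continuousOn
    (by filter_upwards [eventually_pos] with ε hε
        exact ((hU ε hε).continuousOn_exp (-q)).sub continuousOn_const)
    (by filter_upwards [eventually_pos] with ε hε r hr
        exact hb ε _ hε (hU ε hε) r (Ioo_subset_Icc_self hr))
    (fun r hr => by simpa using (tendsto_exp hP hU (-q) ⟨hr.1.le, hr.2⟩).sub_const 1)
  have h2 := hlim.add_const (R ^ N / (N : ℝ))
  rw [zero_add] at h2
  refine h2.congr' ?_
  filter_upwards [eventually_pos] with ε hε
  simp only [mul_sub, mul_one]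
  rw [intervalIntegral.integral_sub ((hU ε hε).intervalIntegrable_weight hR _)
    ((continuous_pow _).intervalIntegrable _ _), integral_weight hP]
  simp [expMass]

lemma tendsto_coef_neg (hP : Admissible N R A B p q g)
    (hU : ∀ ε, 0 < ε → IsRadialNeumannSolution N R A B p q g ε (U ε)) :
    Tendsto (fun ε => coef N R B (-q) (U ε)) (𝓝[>] 0) (𝓝 B) := by
  have hm := (mass_pos hP).ne'
  have h := (tendsto_const_nhds (x := R ^ N / N * B)).div (tendsto_expMass_neg hP hU) hm
  rwa [mul_div_cancel_left₀ _ hm] at h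

/-- The mass of `e^{pU}` may concentrate, so its limit is not computed directly. Instead `a
e^{pU(0)} = v(0) + b e^{-qU(0)}`, whose right-hand side tends to `B`. -/
lemma tendsto_coef (hP : Admissible N R A B p q g)
    (hU : ∀ ε, 0 < ε → IsRadialNeumannSolution N R A B p q g ε (U ε)) :
    Tendsto (fun ε => coef N R A p (U ε)) (𝓝[>] 0) (𝓝 B) := by
  have h0 : (0 : ℝ) ∈ Ico 0 R := ⟨le_rfl, hP.R_pos⟩
  have h := ((tendsto_netCharge hP hU h0).add ((tendsto_coef_neg hP hU).mul
    (tendsto_exp hP hU (-q) h0))).div (tendsto_exp hP hU p h0) one_ne_zero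
  simp only [zero_add, mul_one, div_one] at h
  refine h.congr fun ε => ?_
  have := (Real.exp_pos (p * U ε 0)).ne'
  simp only [Pi.div_apply, netCharge]
  field_simp
  ring

end IsRadialNeumannSolution

end

end CCPB

/-! ### `L^θ` norms of the profile `C ε / (ε² + R - r)`. -/

namespace CCPB

noncomputable section

variable {R θ : ℝ}

lemma memLp_of_continuousOn {f : ℝ → ℝ} (hf : ContinuousOn f (Icc 0 R)) (s : ENNReal) :
    MemLp f s (volume.restrict (Ioo 0 R)) := by
  obtain ⟨M, -, hM⟩ := exists_abs_le hf
  refine MemLp.of_bound ((hf.mono Ioo_subset_Icc_self).aestronglyMeasurable measurableSet_Ioo) M ?_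
  filter_upwards [ae_restrict_mem measurableSet_Ioo] with r hr
  exact hM r (Ioo_subset_Icc_self hr)

lemma lthetaNorm_eq (hθ : 0 < θ) (f : ℝ → ℝ) :
    lthetaNorm R θ f = (∫⁻ r in Ioo 0 R, ‖f r‖ₑ ^ θ) ^ (1 / θ) := by
  rw [lthetaNorm, eLpNorm_eq_lintegral_rpow_enorm_toReal (by simpa using hθ)
    ENNReal.ofReal_ne_top, ENNReal.toReal_ofReal hθ.le]

lemma strongToZero_of_bounded {D : ℝ → ℝ → ℝ} {M : ℝ} (hθ : 0 < θ)
    (hD : ∀ᶠ ε in 𝓝[>] (0 : ℝ), ContinuousOn (D ε) (Icc 0 R))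
    (hb : ∀ᶠ ε in 𝓝[>] (0 : ℝ), ∀ r ∈ Ioo 0 R, |D ε r| ≤ M)
    (hl : ∀ r ∈ Ioo 0 R, Tendsto (fun ε => D ε r) (𝓝[>] 0) (𝓝 0)) :
    StrongToZero R θ D := by
  refine ⟨hD.mono fun ε hε => memLp_of_continuousOn hε _, ?_⟩
  simp only [lthetaNorm_eq hθ]
  have h : Tendsto (fun ε => ∫⁻ r in Ioo 0 R, ‖D ε r‖ₑ ^ θ) (𝓝[>] 0)
      (𝓝 (∫⁻ _ in Ioo 0 R, (0 : ENNReal))) := by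
    refine tendsto_lintegral_filter_of_dominated_convergence' (fun _ => ENNReal.ofReal M ^ θ)
      ?_ ?_ ?_ ?_
    · filter_upwards [hD] with ε hε
      exact (((hε.mono Ioo_subset_Icc_self).aestronglyMeasurable
        measurableSet_Ioo).enorm).pow_const θ
    · filter_upwards [hb] with ε hε
      filter_upwards [ae_restrict_mem measurableSet_Ioo] with r hr
      refine ENNReal.rpow_le_rpow ?_ hθ.le
      rw [← ofReal_norm]
      exact ENNReal.ofReal_le_ofReal (hε r hr)
    · rw [lintegral_const]
      refine ENNReal.mul_ne_top (ENNReal.rpow_ne_top_of_nonneg hθ.le ENNReal.ofReal_ne_top) ?_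
      simp
    · filter_upwards [ae_restrict_mem measurableSet_Ioo] with r hr
      have h1 := ((hl r hr).enorm).ennrpow_const θ
      simpa [hθ] using h1
  have h2 := h.ennrpow_const (1 / θ)
  simpa [hθ] using h2

lemma lthetaNorm_le_of_integral_le {f b : ℝ → ℝ} {I : ℝ} (hR : 0 < R) (hθ : 0 < θ)
    (hb : ContinuousOn b (Icc 0 R)) (hfb : ∀ r ∈ Ioo 0 R, |f r| ≤ b r)
    (hI : ∫ r in (0 : ℝ)..R, b r ^ θ ≤ I) :
    lthetaNorm R θ f ≤ ENNReal.ofReal (I ^ (1 / θ)) := by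
  have hb0 : ∀ r ∈ Ioo 0 R, 0 ≤ b r := fun r hr => (abs_nonneg _).trans (hfb r hr)
  have hbθ : ContinuousOn (fun r => b r ^ θ) (Icc 0 R) :=
    hb.rpow_const fun _ _ => Or.inr hθ.le
  have hint : IntegrableOn (fun r => b r ^ θ) (Ioo 0 R) :=
    (hbθ.integrableOn_compact isCompact_Icc).mono_set Ioo_subset_Icc_self
  have hI' : ∫ r in Ioo 0 R, b r ^ θ ≤ I := by
    rwa [intervalIntegral.integral_of_le hR.le, integral_Ioc_eq_integral_Ioo] at hI
  have hI0 : 0 ≤ I := le_trans (setIntegral_nonneg measurableSet_Ioo fun r hr =>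
    Real.rpow_nonneg (hb0 r hr) _) hI'
  rw [lthetaNorm_eq hθ, ← ENNReal.ofReal_rpow_of_nonneg hI0 (by positivity)]
  refine ENNReal.rpow_le_rpow ?_ (by positivity)
  calc ∫⁻ r in Ioo 0 R, ‖f r‖ₑ ^ θ ≤ ∫⁻ r in Ioo 0 R, ENNReal.ofReal (b r ^ θ) := by
        refine setLIntegral_mono' measurableSet_Ioo fun r hr => ?_
        rw [← ENNReal.ofReal_rpow_of_nonneg (hb0 r hr) hθ.le, ← ofReal_norm]
        exact ENNReal.rpow_le_rpow (ENNReal.ofReal_le_ofReal (hfb r hr)) hθ.le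
    _ = ENNReal.ofReal (∫ r in Ioo 0 R, b r ^ θ) := by
        rw [ofReal_integral_eq_lintegral_ofReal hint]
        filter_upwards [ae_restrict_mem measurableSet_Ioo] with r hr
        exact Real.rpow_nonneg (hb0 r hr) _
    _ ≤ ENNReal.ofReal I := ENNReal.ofReal_le_ofReal hI'

/-- Substitute `y = d + R - r` and discard the favourable endpoint term at `d + R`. -/
lemma integral_rpow_layer_le {d : ℝ} (hR : 0 < R) (hd : 0 < d) (hθ : 1 < θ) :
    ∫ r in (0 : ℝ)..R, (d + (R - r)) ^ (-θ) ≤ d ^ (1 - θ) / (θ - 1) := by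
  have h1 : ∫ r in (0 : ℝ)..R, (d + (R - r)) ^ (-θ) = ∫ y in d..(d + R), y ^ (-θ) := by
    have := intervalIntegral.integral_comp_sub_left (fun y : ℝ => y ^ (-θ)) (d + R)
      (a := 0) (b := R)
    simp only [sub_zero, add_sub_cancel_right] at this
    rw [← this]
    simp only [add_sub_assoc]
  rw [h1, integral_rpow (Or.inr ⟨by linarith, by
    rw [uIcc_of_le (by linarith)]; exact fun h => absurd h.1 (not_le.2 hd)⟩)]
  have h2 : 0 < (d + R) ^ (-θ + 1) := Real.rpow_pos_of_pos (by linarith) _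
  have h3 : ((d + R) ^ (-θ + 1) - d ^ (-θ + 1)) / (-θ + 1)
      = (d ^ (1 - θ) - (d + R) ^ (-θ + 1)) / (θ - 1) := by
    rw [show 1 - θ = -θ + 1 by ring, ← neg_sub (d ^ (-θ + 1)), show -θ + 1 = -(θ - 1) by ring,
      neg_div_neg_eq]
  rw [h3]
  exact div_le_div_of_nonneg_right (by linarith) (by linarith)

lemma integral_inv_layer {d : ℝ} (hR : 0 < R) (hd : 0 < d) :
    ∫ r in (0 : ℝ)..R, (d + (R - r))⁻¹ = Real.log (d + R) - Real.log d := by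
  have := intervalIntegral.integral_comp_sub_left (fun y : ℝ => y⁻¹) (d + R) (a := 0) (b := R)
  simp only [sub_zero, add_sub_cancel_right] at this
  simp only [← add_sub_assoc]
  rw [this, integral_inv_of_pos hd (by linarith), Real.log_div (by linarith) hd.ne']

lemma continuousOn_layer {C ε : ℝ} (hε : 0 < ε) :
    ContinuousOn (fun r => C * ε / (ε ^ 2 + (R - r))) (Icc 0 R) := by
  refine ContinuousOn.div (by fun_prop) (by fun_prop) fun r hr => ?_
  have : 0 < ε ^ 2 := by positivity
  linarith [hr.2]

/-- With `d = ε²` the integral is of order `ε^θ ε^(2 - 2θ) = ε^(2 - θ)`, whose `θ`-th root has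
exponent `2/θ - 1`. -/
lemma lthetaNorm_layer_le_of_one_lt {f : ℝ → ℝ} {C ε : ℝ} (hR : 0 < R) (hC : 0 < C) (hε : 0 < ε)
    (hθ : 1 < θ) (hf : ∀ r ∈ Ioo 0 R, |f r| ≤ C * ε / (ε ^ 2 + (R - r))) :
    lthetaNorm R θ f
      ≤ ENNReal.ofReal (C * (θ - 1)⁻¹ ^ (1 / θ) * ε ^ (2 / θ - 1)) := by
  have hθ0 : 0 < θ := by linarith
  have hε2 : 0 < ε ^ 2 := by positivity
  have h := lthetaNorm_le_of_integral_le (f := f) (I := (C * ε) ^ θ * ((ε ^ 2) ^ (1 - θ) / (θ - 1)))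
    hR hθ0 (continuousOn_layer hε) hf (by
      have : EqOn (fun r => (C * ε / (ε ^ 2 + (R - r))) ^ θ)
          (fun r => (C * ε) ^ θ * (ε ^ 2 + (R - r)) ^ (-θ)) (uIcc 0 R) := by
        intro r hr
        rw [uIcc_of_le hR.le] at hr
        have hx : 0 < ε ^ 2 + (R - r) := by linarith [hr.2]
        simp only
        rw [Real.div_rpow (by positivity) hx.le, Real.rpow_neg hx.le]
        rfl
      rw [intervalIntegral.integral_congr this, intervalIntegral.integral_const_mul]
      exact mul_le_mul_of_nonneg_left (integral_rpow_layer_le hR hε2 hθ) (by positivity))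
  refine h.trans (ENNReal.ofReal_le_ofReal (le_of_eq ?_))
  have hθ1 : 0 < (θ - 1)⁻¹ := inv_pos.2 (by linarith)
  rw [div_eq_mul_inv _ (θ - 1), Real.mul_rpow (by positivity) (by positivity),
    Real.mul_rpow (by positivity) hθ1.le, ← Real.rpow_mul (by positivity),
    mul_one_div_cancel hθ0.ne', Real.rpow_one, ← Real.rpow_mul (by positivity),
    ← Real.rpow_natCast, ← Real.rpow_mul hε.le]
  have : ε ^ (2 / θ - 1) = ε * ε ^ (((2 : ℕ) : ℝ) * ((1 - θ) * (1 / θ))) := by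
    nth_rewrite 2 [← Real.rpow_one ε]
    rw [← Real.rpow_add hε]
    congr 1
    push_cast
    field_simp
    ring
  rw [this]
  ring

lemma lthetaNorm_one_layer_le {f : ℝ → ℝ} {C ε : ℝ} (hR : 0 < R) (hC : 0 < C) (hε : 0 < ε)
    (hε1 : ε ≤ Real.exp (-1)) (hf : ∀ r ∈ Ioo 0 R, |f r| ≤ C * ε / (ε ^ 2 + (R - r))) :
    lthetaNorm R 1 f
      ≤ ENNReal.ofReal (C * (Real.log (1 + R) + 2) * ε * Real.log (1 / ε)) := by
  have hε2 : 0 < ε ^ 2 := by positivity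
  have hεle : ε ≤ 1 := hε1.trans (Real.exp_le_one_iff.2 (by norm_num))
  -- The restriction `ε ≤ e⁻¹` lets the constant `log (1 + R)` be absorbed into the logarithm.
  have hlog : 1 ≤ Real.log (1 / ε) := by
    rw [one_div, Real.log_inv]
    have := Real.log_le_log hε hε1
    rw [Real.log_exp] at this
    linarith
  have h := lthetaNorm_le_of_integral_le (f := f)
    (I := C * (Real.log (1 + R) + 2) * ε * Real.log (1 / ε))
    hR one_pos (continuousOn_layer hε) hf (by
      simp only [Real.rpow_one, div_eq_mul_inv]
      rw [intervalIntegral.integral_const_mul, integral_inv_layer hR hε2]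
      have h1 : Real.log (ε ^ 2 + R) ≤ Real.log (1 + R) :=
        Real.log_le_log (by positivity) (by nlinarith)
      have h2 : Real.log (ε ^ 2) = -2 * Real.log (1 / ε) := by
        rw [Real.log_pow, one_div, Real.log_inv]; push_cast; ring
      have h3 : 0 ≤ Real.log (1 + R) := Real.log_nonneg (by linarith)
      have h4 : Real.log (ε ^ 2 + R) - Real.log (ε ^ 2)
          ≤ (Real.log (1 + R) + 2) * Real.log (1 / ε) := by
        rw [h2]; nlinarith
      have h5 := mul_le_mul_of_nonneg_left h4 (show 0 ≤ C * ε by positivity)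
      rw [← div_eq_mul_inv 1 ε]
      linarith)
  simpa using h

/-- Hölder's inequality on an interval of length `R` reduces `θ ≤ 1` to `θ = 1`. -/
lemma lthetaNorm_le_lthetaNorm_one {f : ℝ → ℝ} (hf : ContinuousOn f (Icc 0 R)) (hR : 0 < R)
    (hθ : 0 < θ) (hθ1 : θ ≤ 1) :
    lthetaNorm R θ f ≤ lthetaNorm R 1 f * ENNReal.ofReal (R ^ (1 / θ - 1)) := by
  have h := eLpNorm_le_eLpNorm_mul_rpow_measure_univ (p := ENNReal.ofReal θ)
    (q := ENNReal.ofReal 1) (μ := volume.restrict (Ioo 0 R)) (f := f)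
    (ENNReal.ofReal_le_ofReal hθ1)
    ((hf.mono Ioo_subset_Icc_self).aestronglyMeasurable measurableSet_Ioo)
  rw [ENNReal.toReal_ofReal hθ.le, ENNReal.toReal_ofReal zero_le_one, Measure.restrict_apply_univ,
    Real.volume_Ioo, sub_zero, ENNReal.ofReal_rpow_of_pos hR, one_div_one] at h
  exact h

/-- The `L^θ` bounds of a family dominated by `C ε / (ε² + R - r)`. -/
lemma layer_ltheta_estimates {f : ℝ → ℝ → ℝ} {C : ℝ} (hR : 0 < R) (hC : 0 < C)
    (hc : ∀ ε, 0 < ε → ContinuousOn (f ε) (Icc 0 R))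
    (hf : ∀ ε, 0 < ε → ε ≤ 1 → ∀ r ∈ Ioo 0 R, |f ε r| ≤ C * ε / (ε ^ 2 + (R - r)))
    (hθ : 0 < θ) (hθ2 : θ < 2) :
    StrongToZero R θ f ∧ ∃ K : ℝ, 0 < K ∧ ∀ᶠ ε in 𝓝[>] (0 : ℝ),
      lthetaNorm R θ (f ε)
        ≤ ENNReal.ofReal (K * ε ^ min 1 (2 / θ - 1) * Real.log (1 / ε) ^ logExponent θ) := by
  have hbound : ∃ K : ℝ, 0 < K ∧ ∀ᶠ ε in 𝓝[>] (0 : ℝ),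
      lthetaNorm R θ (f ε)
        ≤ ENNReal.ofReal (K * ε ^ min 1 (2 / θ - 1) * Real.log (1 / ε) ^ logExponent θ) := by
    rcases le_or_gt θ 1 with h1 | h1
    · have hlog : 0 ≤ Real.log (1 + R) := Real.log_nonneg (by linarith)
      refine ⟨C * (Real.log (1 + R) + 2) * R ^ (1 / θ - 1), by positivity, ?_⟩
      have hmin : min 1 (2 / θ - 1) = 1 := by
        refine min_eq_left ?_
        have : 2 ≤ 2 / θ := by rw [le_div_iff₀ hθ]; linarith
        linarith
      filter_upwards [Ioc_mem_nhdsGT (Real.exp_pos (-1))] with ε hε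
      have hεle : ε ≤ 1 := hε.2.trans (Real.exp_le_one_iff.2 (by norm_num))
      rw [hmin, logExponent, if_pos h1, Real.rpow_one, pow_one]
      refine (lthetaNorm_le_lthetaNorm_one (hc ε hε.1) hR hθ h1).trans ?_
      refine (mul_le_mul_left (lthetaNorm_one_layer_le hR hC hε.1 hε.2 (hf ε hε.1 hεle)) _).trans ?_
      rw [← ENNReal.ofReal_mul' (by positivity)]
      refine ENNReal.ofReal_le_ofReal (le_of_eq (by ring))
    · have hθ1 : 0 < (θ - 1)⁻¹ := inv_pos.2 (by linarith)
      refine ⟨C * (θ - 1)⁻¹ ^ (1 / θ), by positivity, ?_⟩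
      have hmin : min 1 (2 / θ - 1) = 2 / θ - 1 := by
        refine min_eq_right ?_
        have : 2 / θ ≤ 2 := by rw [div_le_iff₀ hθ]; linarith
        linarith
      filter_upwards [eventually_pos_le_one] with ε hε
      rw [hmin, logExponent, if_neg (not_le.2 h1), pow_zero, mul_one]
      exact lthetaNorm_layer_le_of_one_lt hR hC hε.1 h1 (hf ε hε.1 hε.2)
  refine ⟨⟨?_, ?_⟩, hbound⟩
  · filter_upwards [eventually_pos] with ε hε using memLp_of_continuousOn (hc ε hε) _
  obtain ⟨K, hK, hle⟩ := hbound
  -- Here `θ < 2` enters: a positive exponent, which also dominates the logarithm, turns the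
  -- quantitative bound into convergence.
  have hα : 0 < min 1 (2 / θ - 1) := by
    refine lt_min one_pos ?_
    have : 1 < 2 / θ := by rw [lt_div_iff₀ hθ]; linarith
    linarith
  have hlim : Tendsto (fun ε : ℝ =>
      K * ε ^ min 1 (2 / θ - 1) * Real.log (1 / ε) ^ logExponent θ) (𝓝[>] 0) (𝓝 0) := by
    unfold logExponent
    split_ifs
    · have := (tendsto_log_mul_rpow_nhdsGT_zero hα).const_mul (-K)
      rw [mul_zero] at this
      refine this.congr fun ε => ?_
      rw [one_div, Real.log_inv]
      ring
    · have h1 : Tendsto (fun ε : ℝ => ε ^ min 1 (2 / θ - 1)) (𝓝[>] 0) (𝓝 0) := by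
        have := (Real.continuousAt_rpow_const 0 (min 1 (2 / θ - 1)) (Or.inr hα.le)).tendsto
        rw [Real.zero_rpow hα.ne'] at this
        exact this.mono_left nhdsWithin_le_nhds
      simpa using h1.const_mul K
  have h2 := ENNReal.tendsto_ofReal hlim
  rw [ENNReal.ofReal_zero] at h2
  exact tendsto_of_tendsto_of_tendsto_of_le_of_le' tendsto_const_nhds h2
    (Eventually.of_forall fun _ => zero_le) hle

end

end CCPB

/-! ### Symmetry between the species, weak limits, and conclusion. -/

namespace CCPB

noncomputable section

variable {N : ℕ} {R A B p q : ℝ} {g : ℝ → ℝ}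

lemma intervalIntegrable_mul_of_continuousOn {h f : ℝ → ℝ} (hR : 0 < R)
    (hh : ContinuousOn h (Icc 0 R)) (hf : ContinuousOn f (Icc 0 R)) :
    IntervalIntegrable (fun r => h r * f r) volume 0 R := by
  apply ContinuousOn.intervalIntegrable
  rw [uIcc_of_le hR.le]
  exact hh.mul hf

lemma rDeriv_neg (U : ℝ → ℝ) : rDeriv R (fun r => -U r) = fun r => -rDeriv R U r := by
  funext r
  exact derivWithin.fun_neg

lemma expMass_neg (c : ℝ) (U : ℝ → ℝ) : expMass N R c (fun r => -U r) = expMass N R (-c) U := by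
  simp [expMass]

namespace IsRadialNeumannSolution

/-- Changing the sign of the potential exchanges the two ion species. -/
lemma neg {ε : ℝ} {U : ℝ → ℝ} (hU : IsRadialNeumannSolution N R A B p q g ε U) :
    IsRadialNeumannSolution N R B A q p g ε (fun r => -U r) where
  contDiffOn_closed := hU.contDiffOn_closed.neg
  contDiffOn_open := hU.contDiffOn_open.neg
  equation r hr := by
    have h := hU.equation r hr
    rw [rDeriv_neg, rDeriv_neg, expMass_neg, expMass_neg, neg_neg]
    simp only [mul_neg, neg_mul, neg_neg] at h ⊢
    linear_combination -h
  mean_zero := by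
    have h := hU.mean_zero
    simp only [mul_neg, intervalIntegral.integral_neg, h, neg_zero]
  deriv_zero := by
    rw [rDeriv_neg]
    simp [hU.deriv_zero]
  deriv_right := by
    rw [rDeriv_neg]
    simp only [hU.deriv_right]
    ring

variable {U : ℝ → ℝ → ℝ}

lemma tendsto_integral_netCharge (hP : Admissible N R A B p q g)
    (hU : ∀ ε, 0 < ε → IsRadialNeumannSolution N R A B p q g ε (U ε)) {h : ℝ → ℝ}
    (hh : ContinuousOn h (Icc 0 R)) :
    Tendsto (fun ε => ∫ r in (0 : ℝ)..R, h r * netCharge N R A B p q (U ε) r) (𝓝[>] 0)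
      (𝓝 (R * (A - B) / N * h R)) := by
  -- Dividing the mass `R^N (A - B) / N` by the weight `R^(N-1)` at the endpoint gives `R (A - B) /
  -- N`.
  have h1 := tendsto_integral_of_concentrating (n := N - 1) (m := R ^ N / N * (A - B)) hP.R_pos
    (fun ε hε => (hU ε hε).continuousOn_netCharge)
    (fun ε hε r hr => (hU ε hε).netCharge_nonneg hP hε hr)
    (fun ε hε => (hU ε hε).monotoneOn_netCharge hP hε)
    (fun ε hε => (hU ε hε).integral_weight_netCharge hP)
    (fun r hr => tendsto_netCharge hP hU hr) hh
  convert h1 using 3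
  have hR := hP.R_pos.ne'
  have hpow : R ^ N = R ^ (N - 1) * R := by
    rw [← pow_succ]; congr 1; have := hP.two_le; omega
  rw [hpow]
  field_simp

lemma weakToDelta_chargeDensity (hP : Admissible N R A B p q g)
    (hU : ∀ ε, 0 < ε → IsRadialNeumannSolution N R A B p q g ε (U ε)) :
    WeakToDelta R (fun ε => chargeDensity N R A B p q (U ε)) (R * (B - A) / N) := by
  refine ⟨?_, fun h hh => ⟨?_, ?_⟩⟩
  · exact div_ne_zero (mul_ne_zero hP.R_pos.ne' (sub_neg.2 hP.B_lt_A).ne) hP.N_pos.ne'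
  · filter_upwards [eventually_pos] with ε hε
    simp only [chargeDensity_eq_neg]
    exact intervalIntegrable_mul_of_continuousOn hP.R_pos hh (hU ε hε).continuousOn_netCharge.neg
  · simp only [chargeDensity_eq_neg, mul_neg, intervalIntegral.integral_neg]
    convert (tendsto_integral_netCharge hP hU hh).neg using 2
    ring

lemma strongToZero_exp_neg (hP : Admissible N R A B p q g)
    (hU : ∀ ε, 0 < ε → IsRadialNeumannSolution N R A B p q g ε (U ε)) {θ : ℝ} (hθ : 0 < θ) :
    StrongToZero R θ (fun ε r => Real.exp (-q * U ε r) - 1) := by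
  obtain ⟨M, -, hb⟩ := exists_abs_exp_neg_sub_one_le hP
  refine strongToZero_of_bounded (M := M) hθ ?_ ?_ fun r hr => ?_
  · filter_upwards [eventually_pos] with ε hε
    exact ((hU ε hε).continuousOn_exp (-q)).sub continuousOn_const
  · filter_upwards [eventually_pos] with ε hε r hr
    exact hb ε _ hε (hU ε hε) r (Ioo_subset_Icc_self hr)
  · simpa using (tendsto_exp hP hU (-q) ⟨hr.1.le, hr.2⟩).sub_const 1

/-- Solving the definition of `v` gives `e^{pU} - 1 = v / a + (k e^{-qU} - 1)` with `k = b / a`. The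
first term concentrates with `a → B`; the second is bounded and tends to zero pointwise inside. -/
lemma weakToDelta_exp (hP : Admissible N R A B p q g)
    (hU : ∀ ε, 0 < ε → IsRadialNeumannSolution N R A B p q g ε (U ε)) :
    WeakToDelta R (fun ε r => Real.exp (p * U ε r) - 1) (R * (A - B) / (B * N)) := by
  have hR := hP.R_pos
  have hN := hP.N_pos
  have hB := hP.B_pos
  have hAB := sub_pos.2 hP.B_lt_A
  refine ⟨by positivity, fun h hh => ⟨?_, ?_⟩⟩
  · filter_upwards [eventually_pos] with ε hε
    exact intervalIntegrable_mul_of_continuousOn hR hh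
      (((hU ε hε).continuousOn_exp p).sub continuousOn_const)
  set k : ℝ → ℝ := fun ε => coef N R B (-q) (U ε) / coef N R A p (U ε) with hk
  have hklim : Tendsto k (𝓝[>] 0) (𝓝 1) := by
    have := (tendsto_coef_neg hP hU).div (tendsto_coef hP hU) hB.ne'
    rwa [div_self hB.ne'] at this
  -- The coefficient bounds are separated by `B`: `b ≤ B ≤ a`.
  have hk1 : ∀ ε, 0 < ε → 0 ≤ k ε ∧ k ε ≤ 1 := fun ε hε => by
    have ha := (hU ε hε).coef_pos hP hP.A_pos p
    have hb := (hU ε hε).coef_pos hP hB (-q)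
    refine ⟨(div_pos hb ha).le, (div_le_one ha).2 ?_⟩
    exact ((hU ε hε).coef_le hP hB _).trans ((hU ε hε).le_coef hP hε)
  have hD : ∀ ε, 0 < ε →
      ContinuousOn (fun r => k ε * Real.exp (-q * U ε r) - 1) (Icc 0 R) := fun ε hε =>
    (((hU ε hε).continuousOn_exp (-q)).const_mul _).sub continuousOn_const
  have h1 := tendsto_integral_mul_of_bounded
    (D := fun ε r => k ε * Real.exp (-q * U ε r) - 1) (h := h)
    (C := Real.exp (-q * (Real.log (B / A) / p)) + 1) hR hh
    (by filter_upwards [eventually_pos] with ε hε using hD ε hε)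
    (by filter_upwards [eventually_pos] with ε hε r hr
        have h1 := (hU ε hε).exp_neg_le hP hε (Ioo_subset_Icc_self hr)
        have h2 := Real.exp_pos (-q * U ε r)
        obtain ⟨h3, h4⟩ := hk1 ε hε
        exact abs_le.2 ⟨by nlinarith, by nlinarith⟩)
    (fun r hr => by
      simpa using (hklim.mul (tendsto_exp hP hU (-q) ⟨hr.1.le, hr.2⟩)).sub_const 1)
  have h2 := ((tendsto_integral_netCharge hP hU hh).div (tendsto_coef hP hU) hB.ne').add h1
  have h3 : R * (A - B) / (B * N) * h R = R * (A - B) / N * h R / B + 0 := by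
    field_simp; ring
  rw [h3]
  refine h2.congr' ?_
  filter_upwards [eventually_pos] with ε hε
  have ha := ((hU ε hε).coef_pos hP hP.A_pos p).ne'
  simp only [Pi.div_apply]
  rw [← intervalIntegral.integral_div, ← intervalIntegral.integral_add
    ((intervalIntegrable_mul_of_continuousOn hR hh (hU ε hε).continuousOn_netCharge).div_const _)
    (intervalIntegrable_mul_of_continuousOn hR hh (hD ε hε))]
  congr 1
  funext r
  simp only [hk, netCharge]
  field_simp
  ring

/-- Divide the energy balance by `r^(2(N-1)) g² / 2` and insert `energy_eq`: the leading term is `2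
v / (p g)`, and the three remainders appear on the right. -/
lemma exists_sq_sub_le (hP : Admissible N R A B p q g) :
    ∃ C : ℝ, 0 < C ∧ ∀ (ε : ℝ) (U : ℝ → ℝ), 0 < ε →
      IsRadialNeumannSolution N R A B p q g ε U → ∀ r ∈ Ioo 0 R,
        |(ε * rDeriv R U r) ^ 2 - 2 / (p * g r) * netCharge N R A B p q U r|
          ≤ C * (flux N R g ε U r / (r ^ (N - 1)) ^ 2 + netCharge N R A B p q U 0
            + |Real.exp (-q * U r) - Real.exp (-q * U 0)|) := by
  obtain ⟨g₀, g₁, hg₀, -, hg⟩ := hP.exists_bounds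
  obtain ⟨K, hK, hbal⟩ := exists_energy_balance hP
  have hp := hP.p_pos
  have hq := hP.q_pos
  have hB := hP.B_pos
  refine ⟨2 * K / g₀ ^ 2 + 2 / (p * g₀) + 2 / g₀ * (B * (1 / p + 1 / q)), by positivity,
    fun ε U hε hU r hr => ?_⟩
  have hrI := Ioo_subset_Icc_self hr
  have hgr := hP.g_pos r hrI
  have hggr := (hg r hrI).1
  have hx : 0 < r ^ (N - 1) := pow_pos hr.1 _
  have hW := hU.flux_nonneg hP hε hrI
  have hv0 := hU.netCharge_nonneg hP hε (r := 0) ⟨le_rfl, hP.R_pos.le⟩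
  have hb0 := hU.coef_pos hP hB (-q)
  have hbB := hU.coef_le hP hB (-q)
  have hH := hbal ε U hε hU r hrI
  set H := flux N R g ε U r ^ 2 / (2 * ε ^ 2)
    - (r ^ (N - 1)) ^ 2 * g r * energy N R A B p q U r with hHdef
  set X := Real.exp (-q * U r) - Real.exp (-q * U 0) with hX
  set b := coef N R B (-q) U with hb
  have hid : (ε * rDeriv R U r) ^ 2 - 2 / (p * g r) * netCharge N R A B p q U r
      = 2 / ((r ^ (N - 1)) ^ 2 * g r ^ 2) * H + -(2 / (p * g r) * netCharge N R A B p q U 0)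
        + 2 / g r * (b * (1 / p + 1 / q)) * X := by
    have h1 : (ε * rDeriv R U r) ^ 2
        = 2 / ((r ^ (N - 1)) ^ 2 * g r ^ 2) * (flux N R g ε U r ^ 2 / (2 * ε ^ 2)) := by
      unfold flux; field_simp
    rw [h1, hHdef, energy_eq hP, ← hX, ← hb]
    field_simp
    ring
  rw [hid]
  have e1 : |2 / ((r ^ (N - 1)) ^ 2 * g r ^ 2) * H|
      ≤ 2 * K / g₀ ^ 2 * (flux N R g ε U r / (r ^ (N - 1)) ^ 2) := by
    rw [abs_mul, abs_of_pos (by positivity)]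
    calc _ ≤ 2 / ((r ^ (N - 1)) ^ 2 * g₀ ^ 2) * (K * flux N R g ε U r) := by gcongr
      _ = _ := by field_simp
  have e2 : |-(2 / (p * g r) * netCharge N R A B p q U 0)|
      ≤ 2 / (p * g₀) * netCharge N R A B p q U 0 := by
    rw [abs_neg, abs_of_nonneg (by positivity)]
    gcongr
  have e3 : |2 / g r * (b * (1 / p + 1 / q)) * X| ≤ 2 / g₀ * (B * (1 / p + 1 / q)) * |X| := by
    rw [abs_mul, abs_of_pos (by positivity)]
    gcongr
  refine (abs_add_three _ _ _).trans ((add_le_add (add_le_add e1 e2) e3).trans ?_)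
  have f1 : 0 ≤ flux N R g ε U r / (r ^ (N - 1)) ^ 2 := by positivity
  have c1 : 0 < 2 * K / g₀ ^ 2 := by positivity
  have c2 : 0 < 2 / (p * g₀) := by positivity
  have c3 : 0 < 2 / g₀ * (B * (1 / p + 1 / q)) := by positivity
  nlinarith [mul_nonneg c1.le hv0, mul_nonneg c1.le (abs_nonneg X), mul_nonneg c2.le f1,
    mul_nonneg c2.le (abs_nonneg X), mul_nonneg c3.le f1, mul_nonneg c3.le hv0]

lemma tendsto_sq_sub (hP : Admissible N R A B p q g)
    (hU : ∀ ε, 0 < ε → IsRadialNeumannSolution N R A B p q g ε (U ε)) {r : ℝ} (hr : r ∈ Ioo 0 R) :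
    Tendsto (fun ε => (ε * rDeriv R (U ε) r) ^ 2
      - 2 / (p * g r) * netCharge N R A B p q (U ε) r) (𝓝[>] 0) (𝓝 0) := by
  obtain ⟨C, hC, hle⟩ := exists_sq_sub_le hP
  have hrI := Ioo_subset_Icc_self hr
  have h0 : (0 : ℝ) ∈ Ico 0 R := ⟨le_rfl, hP.R_pos⟩
  have hr' : r ∈ Ico 0 R := ⟨hr.1.le, hr.2⟩
  have hW : Tendsto (fun ε => flux N R g ε (U ε) r) (𝓝[>] 0) (𝓝 0) := by
    refine squeeze_zero' (g := fun ε => r ^ (N - 1) * netCharge N R A B p q (U ε) r * r) ?_ ?_ ?_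
    · filter_upwards [eventually_pos] with ε hε using (hU ε hε).flux_nonneg hP hε hrI
    · filter_upwards [eventually_pos] with ε hε using (hU ε hε).flux_le_pow_mul hP hε hrI
    · simpa using ((tendsto_netCharge hP hU hr').const_mul (r ^ (N - 1))).mul_const r
  have hX := ((tendsto_exp hP hU (-q) hr').sub (tendsto_exp hP hU (-q) h0)).abs
  have hlim := (((hW.div_const ((r ^ (N - 1)) ^ 2)).add (tendsto_netCharge hP hU h0)).add
    hX).const_mul C
  simp only [zero_div, sub_self, abs_zero, add_zero, mul_zero] at hlim
  refine squeeze_zero_norm' ?_ hlim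
  filter_upwards [eventually_pos] with ε hε using hle ε _ hε (hU ε hε) r hr

/-- The remainder bound degenerates at the origin through division by `r^(2(N-1))`. It is therefore
used only for `r ≥ R/2`; elsewhere `ε U'` and `v` are each bounded. -/
lemma exists_abs_sq_sub_le (hP : Admissible N R A B p q g) :
    ∃ M : ℝ, ∀ (ε : ℝ) (U : ℝ → ℝ), 0 < ε → ε ≤ 1 →
      IsRadialNeumannSolution N R A B p q g ε U → ∀ r ∈ Ioo 0 R,
        |(ε * rDeriv R U r) ^ 2 - 2 / (p * g r) * netCharge N R A B p q U r| ≤ M := by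
  obtain ⟨g₀, g₁, hg₀, -, hg⟩ := hP.exists_bounds
  obtain ⟨C, hC, hle⟩ := exists_sq_sub_le hP
  obtain ⟨C₁, hC₁, hd⟩ := exists_rDeriv_le hP
  obtain ⟨C₂, hC₂, hv⟩ := exists_netCharge_le hP
  obtain ⟨M, hM, hexp⟩ := exists_abs_exp_neg_sub_one_le hP
  have hR := hP.R_pos
  have hp := hP.p_pos
  have hN := hP.N_pos
  have hAB := sub_pos.2 hP.B_lt_A
  refine ⟨max (C * (R ^ N * (A - B) / N / ((R / 2) ^ (N - 1)) ^ 2 + C₂ / R ^ 2 + (M + M)))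
    ((2 * C₁ / R) ^ 2 + 2 / (p * g₀) * (4 * C₂ / R ^ 2)), fun ε U hε hε1 hU r hr => ?_⟩
  have hrI := Ioo_subset_Icc_self hr
  have h0I : (0 : ℝ) ∈ Icc 0 R := ⟨le_rfl, hR.le⟩
  have hε2 : ε ^ 2 ≤ 1 := pow_le_one₀ hε.le hε1
  rcases le_total (R / 2) r with h | h
  · refine le_max_of_le_left ((hle ε U hε hU r hr).trans ?_)
    have h1 : flux N R g ε U r ≤ R ^ N * (A - B) / N := by
      rw [← hU.flux_right hP hε]
      exact hU.monotoneOn_flux hP hε hrI ⟨hR.le, le_rfl⟩ hr.2.le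
    have h2 : netCharge N R A B p q U 0 ≤ C₂ / R ^ 2 := by
      rw [le_div_iff₀ (by positivity)]
      have := hv ε U hε hU 0 h0I
      rw [sub_zero] at this
      nlinarith
    have h3 : |Real.exp (-q * U r) - Real.exp (-q * U 0)| ≤ M + M := by
      have e1 := abs_le.1 (hexp ε U hε hU r hrI)
      have e2 := abs_le.1 (hexp ε U hε hU 0 h0I)
      exact abs_le.2 ⟨by linarith [e1.1, e2.2], by linarith [e1.2, e2.1]⟩
    gcongr
  · refine le_max_of_le_right ?_
    have hx : R / 2 ≤ R - r := by linarith
    have hd0 := hU.rDeriv_nonneg hP hε hrI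
    have hv0 := hU.netCharge_nonneg hP hε hrI
    have h1 : rDeriv R U r ≤ 2 * C₁ / R := by
      rw [le_div_iff₀ hR]
      have := hd ε U hε hε1 hU r hrI
      nlinarith [mul_nonneg hd0 (sq_nonneg ε)]
    have h2 : ε * rDeriv R U r ≤ 2 * C₁ / R := by nlinarith
    have h3 : netCharge N R A B p q U r ≤ 4 * C₂ / R ^ 2 := by
      rw [le_div_iff₀ (by positivity)]
      have e1 := hv ε U hε hU r hrI
      have e2 : (R / 2) ^ 2 ≤ (R - r) ^ 2 := pow_le_pow_left₀ (by positivity) hx 2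
      nlinarith [mul_le_mul_of_nonneg_left e2 hv0]
    have hggr := (hg r hrI).1
    have hgr := hP.g_pos r hrI
    refine (abs_sub _ _).trans ?_
    rw [abs_of_nonneg (by positivity), abs_of_nonneg (by positivity)]
    gcongr

lemma weakToDelta_sq (hP : Admissible N R A B p q g)
    (hU : ∀ ε, 0 < ε → IsRadialNeumannSolution N R A B p q g ε (U ε)) :
    WeakToDelta R (fun ε r => (ε * rDeriv R (U ε) r) ^ 2) (2 * R * (A - B) / (p * N * g R)) := by
  obtain ⟨M, hM⟩ := exists_abs_sq_sub_le hP
  have hR := hP.R_pos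
  have hN := hP.N_pos
  have hp := hP.p_pos
  have hAB := sub_pos.2 hP.B_lt_A
  have hgR := hP.g_pos R ⟨hR.le, le_rfl⟩
  have hsq : ∀ ε, 0 < ε → ContinuousOn (fun r => (ε * rDeriv R (U ε) r) ^ 2) (Icc 0 R) :=
    fun ε hε => ((continuousOn_rDeriv hR (hU ε hε).contDiffOn_closed).const_mul ε).pow 2
  have hginv : ContinuousOn (fun r => 2 / (p * g r)) (Icc 0 R) :=
    continuousOn_const.div (hP.smooth.continuousOn.const_mul p) fun r hr =>
      (mul_pos hp (hP.g_pos r hr)).ne'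
  have hD : ∀ ε, 0 < ε → ContinuousOn (fun r => (ε * rDeriv R (U ε) r) ^ 2
      - 2 / (p * g r) * netCharge N R A B p q (U ε) r) (Icc 0 R) := fun ε hε =>
    (hsq ε hε).sub (hginv.mul (hU ε hε).continuousOn_netCharge)
  refine ⟨by positivity, fun h hh => ⟨?_, ?_⟩⟩
  · filter_upwards [eventually_pos] with ε hε
    exact intervalIntegrable_mul_of_continuousOn hR hh (hsq ε hε)
  have h1 := tendsto_integral_mul_of_bounded
    (D := fun ε r => (ε * rDeriv R (U ε) r) ^ 2
      - 2 / (p * g r) * netCharge N R A B p q (U ε) r) (C := M) hR hh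
    (by filter_upwards [eventually_pos] with ε hε using hD ε hε)
    (by filter_upwards [eventually_pos_le_one] with ε hε r hr
        exact hM ε _ hε.1 hε.2 (hU ε hε.1) r hr)
    (fun r hr => tendsto_sq_sub hP hU hr)
  -- Testing `v` against `2 h / (p g)` yields the factor `1 / g(R)` in the limit.
  have h2 := (tendsto_integral_netCharge hP hU (hh.mul hginv)).add h1
  have h3 : 2 * R * (A - B) / (p * N * g R) * h R
      = R * (A - B) / N * (h R * (2 / (p * g R))) + 0 := by
    field_simp; ring
  rw [h3]
  refine h2.congr' ?_
  filter_upwards [eventually_pos] with ε hε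
  rw [← intervalIntegral.integral_add
    (intervalIntegrable_mul_of_continuousOn hR (hh.mul hginv) (hU ε hε).continuousOn_netCharge)
    (intervalIntegrable_mul_of_continuousOn hR hh (hD ε hε))]
  congr 1
  funext r
  simp only [Pi.mul_apply]
  ring

lemma ltheta_estimates (hP : Admissible N R A B p q g)
    (hU : ∀ ε, 0 < ε → IsRadialNeumannSolution N R A B p q g ε (U ε)) {θ : ℝ} (hθ : 0 < θ)
    (hθ2 : θ < 2) :
    StrongToZero R θ (fun ε r => ε * rDeriv R (U ε) r) ∧
      ∃ C : ℝ, 0 < C ∧ ∀ᶠ ε in 𝓝[>] (0 : ℝ),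
        lthetaNorm R θ (fun r => ε * rDeriv R (U ε) r)
          ≤ ENNReal.ofReal (C * ε ^ min 1 (2 / θ - 1)
              * Real.log (1 / ε) ^ logExponent θ) := by
  obtain ⟨C, hC, hd⟩ := exists_rDeriv_le hP
  refine layer_ltheta_estimates hP.R_pos hC (fun ε hε =>
    (continuousOn_rDeriv hP.R_pos (hU ε hε).contDiffOn_closed).const_mul ε) ?_ hθ hθ2
  intro ε hε hε1 r hr
  have hrI := Ioo_subset_Icc_self hr
  have hx : 0 < ε ^ 2 + (R - r) := add_pos (by positivity) (sub_pos.2 hr.2)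
  have h1 := hd ε _ hε hε1 (hU ε hε) r hrI
  have h2 := (hU ε hε).rDeriv_nonneg hP hε hrI
  rw [abs_of_nonneg (by positivity), le_div_iff₀ hx]
  nlinarith

end IsRadialNeumannSolution

lemma lthetaNorm_neg (R θ : ℝ) (f : ℝ → ℝ) : lthetaNorm R θ (fun r => -f r) = lthetaNorm R θ f :=
  eLpNorm_neg f _ _

lemma StrongToZero.neg {θ : ℝ} {f : ℝ → ℝ → ℝ} (hf : StrongToZero R θ f) :
    StrongToZero R θ (fun ε r => -f ε r) := by
  refine ⟨hf.1.mono fun ε hε => hε.neg, ?_⟩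
  simpa only [lthetaNorm_neg] using hf.2

lemma WeakToDelta.neg {c : ℝ} {f : ℝ → ℝ → ℝ} (hf : WeakToDelta R f c) :
    WeakToDelta R (fun ε r => -f ε r) (-c) := by
  refine ⟨neg_ne_zero.2 hf.1, fun h hh => ?_⟩
  obtain ⟨h1, h2⟩ := hf.2 h hh
  simp only [mul_neg, intervalIntegral.integral_neg, neg_mul]
  exact ⟨h1.mono fun ε hε => hε.neg, h2.neg⟩

lemma chargeDensity_neg (U : ℝ → ℝ) (r : ℝ) :
    chargeDensity N R B A q p (fun s => -U s) r = -chargeDensity N R A B p q U r := by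
  simp only [chargeDensity, expMass_neg, neg_neg, mul_neg, neg_mul]
  ring

end

end CCPB

theorem theorem4p1 (N : ℕ) (hN : 2 ≤ N) (R A B p q : ℝ) (hR : 0 < R)
    (hA : 0 < A) (hB : 0 < B) (hp : 0 < p) (hq : 0 < q) (hAB : A ≠ B)
    (g : ℝ → ℝ) (hg : ContDiffOn ℝ (⊤ : ℕ∞) g (Icc 0 R)) (hgpos : ∀ r ∈ Icc 0 R, 0 < g r)
    (U : ℝ → ℝ → ℝ)
    (hU : ∀ ε : ℝ, 0 < ε → CCPB.IsRadialNeumannSolution N R A B p q g ε (U ε)) :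
    CCPB.WeakToDelta R (fun ε => CCPB.chargeDensity N R A B p q (U ε)) (R * (B - A) / N) ∧
    (A < B →
      CCPB.WeakToDelta R (fun ε r => (ε * CCPB.rDeriv R (U ε) r) ^ 2)
        (2 * R * (B - A) / (q * N * g R)) ∧
      CCPB.WeakToDelta R (fun ε r => Real.exp (-q * U ε r) - 1) (R * (B - A) / (A * N)) ∧
      ∀ θ : ℝ, 0 < θ → CCPB.StrongToZero R θ (fun ε r => Real.exp (p * U ε r) - 1)) ∧
    (B < A →
      CCPB.WeakToDelta R (fun ε r => (ε * CCPB.rDeriv R (U ε) r) ^ 2)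
        (2 * R * (A - B) / (p * N * g R)) ∧
      CCPB.WeakToDelta R (fun ε r => Real.exp (p * U ε r) - 1) (R * (A - B) / (B * N)) ∧
      ∀ θ : ℝ, 0 < θ → CCPB.StrongToZero R θ (fun ε r => Real.exp (-q * U ε r) - 1)) ∧
    (∀ θ : ℝ, 0 < θ → θ < 2 →
      CCPB.StrongToZero R θ (fun ε r => ε * CCPB.rDeriv R (U ε) r) ∧
      ∃ C : ℝ, 0 < C ∧ ∀ᶠ ε in 𝓝[>] (0 : ℝ),
        CCPB.lthetaNorm R θ (fun r => ε * CCPB.rDeriv R (U ε) r)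
          ≤ ENNReal.ofReal (C * ε ^ min 1 (2 / θ - 1)
              * Real.log (1 / ε) ^ CCPB.logExponent θ)) := by
  rcases lt_or_gt_of_ne hAB with hlt | hlt
  -- For `A < B`, the reflected potential `-U` solves the problem with the species exchanged, and
  -- each conclusion is translated back.
  · have hP : CCPB.Admissible N R B A q p g := ⟨hN, hR, hA, hlt, hq, hp, hg, hgpos⟩
    have hV : ∀ ε : ℝ, 0 < ε → CCPB.IsRadialNeumannSolution N R B A q p g ε
        ((fun ε r => -U ε r) ε) := fun ε hε => (hU ε hε).neg
    refine ⟨?_, fun _ => ⟨?_, ?_, fun θ hθ => ?_⟩, fun h => absurd h (not_lt.2 hlt.le),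
      fun θ hθ hθ2 => ?_⟩
    · have h := (CCPB.IsRadialNeumannSolution.weakToDelta_chargeDensity hP hV).neg
      simp only [CCPB.chargeDensity_neg, neg_neg] at h
      convert h using 1
      ring
    · have h := CCPB.IsRadialNeumannSolution.weakToDelta_sq hP hV
      simpa only [CCPB.rDeriv_neg, mul_neg, neg_sq] using h
    · have h := CCPB.IsRadialNeumannSolution.weakToDelta_exp hP hV
      simpa only [mul_neg, neg_mul] using h
    · have h := CCPB.IsRadialNeumannSolution.strongToZero_exp_neg hP hV hθ
      simpa only [mul_neg, neg_mul, neg_neg] using h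
    · obtain ⟨h1, C, hC, h2⟩ := CCPB.IsRadialNeumannSolution.ltheta_estimates hP hV hθ hθ2
      have h3 := h1.neg
      simp only [CCPB.rDeriv_neg, mul_neg, neg_neg] at h3
      simp only [CCPB.rDeriv_neg, mul_neg, CCPB.lthetaNorm_neg] at h2
      exact ⟨h3, C, hC, h2⟩
  · have hP : CCPB.Admissible N R A B p q g := ⟨hN, hR, hB, hlt, hp, hq, hg, hgpos⟩
    exact ⟨CCPB.IsRadialNeumannSolution.weakToDelta_chargeDensity hP hU,
      fun h => absurd h (not_lt.2 hlt.le),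
      fun _ => ⟨CCPB.IsRadialNeumannSolution.weakToDelta_sq hP hU,
        CCPB.IsRadialNeumannSolution.weakToDelta_exp hP hU,
        fun _ hθ => CCPB.IsRadialNeumannSolution.strongToZero_exp_neg hP hU hθ⟩,
      fun _ hθ hθ2 => CCPB.IsRadialNeumannSolution.ltheta_estimates hP hU hθ hθ2⟩
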